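/- Let $Y$ be a set of $n\ge 1$ points (clients) in the Euclidean plane. A collinear disk cover of $Y$ is a finite family of closed disks (radius $0$ allowed) whose centers all lie on one common line, of arbitrary position and orientation, such that every point of $Y$ lies in at least one of the disks. Its (linear, $\alpha=1$) cost is the sum of the radii, and $OPT$ is the minimum cost of a collinear disk cover of $Y$. On a real RAM (exact real arithmetic $+,-,\times,/,\sqrt{\cdot}$, comparisons, integer addition and subtraction, and indirect addressing at unit cost; no floor function), there is a single algorithm that, given $n$, the coordinates of the points of $Y$, and a real number $\varepsilon>0$, computes a collinear disk cover of $Y$ (centers and radii) of cost at most $(1+\varepsilon)\,OPT$ in time $$O\!\left(\left(\frac{n^4}{\varepsilon^2}+n\right)\log (n+1)\right),$$ with an absolute constant. In particular, for $n\ge 2$ and $0<\varepsilon\le n^{3/2}$, and so for all $0<\varepsilon\le 1$, the running time is $O\big((n^4/\varepsilon^2)\log n\big)$. -/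

import Mathlib

/-! ### Collinear disk covers in the Euclidean plane -/

/-- The Euclidean plane. -/
abbrev Plane : Type := EuclideanSpace ℝ (Fin 2)

/-- A disk, given by its center and its radius. -/
structure Disk where
  center : Plane
  radius : ℝ

/-- The linear cost of a finite family of disks: the sum of the radii. -/
noncomputable def diskCost {k : ℕ} (D : Fin k → Disk) : ℝ := ∑ j, (D j).radius

/-- A finite family of disks (of nonnegative radius) whose centers lie on a common line and
which covers the set `Y` of clients: each client is within range of some disk. -/
structure IsCollinearCover (Y : Set Plane) {k : ℕ} (D : Fin k → Disk) : Prop where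
  radius_nonneg : ∀ j, 0 ≤ (D j).radius
  collinear : Collinear ℝ (Set.range fun j => (D j).center)
  covers : ∀ p ∈ Y, ∃ j, dist (D j).center p ≤ (D j).radius

/-- `OPT`: the least cost of a collinear disk cover of `Y`, over all lines, all numbers of disks,
all centers on the line and all radii. -/
noncomputable def collinearOpt (Y : Set Plane) : ℝ :=
  sInf {v : ℝ | ∃ (k : ℕ) (D : Fin k → Disk), IsCollinearCover Y D ∧ diskCost D = v}

/-! ### The real RAM

A real RAM with exact real arithmetic `+, -, *, /, √`, comparisons, and integer registers for
counting and (indirect) addressing, programmed in a structured language.  Every operation, memory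
access, comparison, assignment and branching costs one step.  There are no real constants in
programs, and there is no conversion from reals to integers (no floor function). -/

namespace RealRAM

/-- The memory: scalar registers and arrays, holding natural numbers or reals.  Registers and
arrays are named by numerals that are fixed in the program. -/
structure Store where
  natVar : ℕ → ℕ
  realVar : ℕ → ℝ
  natArr : ℕ → ℕ → ℕ
  realArr : ℕ → ℕ → ℝ

/-- Expressions for natural numbers (subtraction is truncated). -/
inductive NatExp : Type
  | lit (m : ℕ)
  | var (x : ℕ)
  | arr (a : ℕ) (i : NatExp)
  | add (e f : NatExp)
  | sub (e f : NatExp)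

/-- Expressions for real numbers. -/
inductive RealExp : Type
  | cast (e : NatExp)
  | var (x : ℕ)
  | arr (a : ℕ) (i : NatExp)
  | add (e f : RealExp)
  | sub (e f : RealExp)
  | mul (e f : RealExp)
  | div (e f : RealExp)
  | sqrt (e : RealExp)

/-- Tests. -/
inductive Test : Type
  | natLe (e f : NatExp)
  | realLe (e f : RealExp)
  | neg (b : Test)
  | conj (b c : Test)

/-- The value of an expression. -/
def NatExp.eval (s : Store) : NatExp → ℕ
  | lit m => m
  | var x => s.natVar x
  | arr a i => s.natArr a (i.eval s)
  | add e f => e.eval s + f.eval s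
  | sub e f => e.eval s - f.eval s

/-- The number of operations and memory accesses in an expression. -/
def NatExp.cost : NatExp → ℕ
  | lit _ => 1
  | var _ => 1
  | arr _ i => 1 + i.cost
  | add e f => 1 + e.cost + f.cost
  | sub e f => 1 + e.cost + f.cost

/-- The value of an expression.  A division by zero and the square root of a negative number
return zero. -/
noncomputable def RealExp.eval (s : Store) : RealExp → ℝ
  | cast e => (e.eval s : ℝ)
  | var x => s.realVar x
  | arr a i => s.realArr a (i.eval s)
  | add e f => e.eval s + f.eval s
  | sub e f => e.eval s - f.eval s
  | mul e f => e.eval s * f.eval s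
  | div e f => e.eval s / f.eval s
  | sqrt e => Real.sqrt (e.eval s)

/-- The number of operations and memory accesses in an expression. -/
def RealExp.cost : RealExp → ℕ
  | cast e => 1 + e.cost
  | var _ => 1
  | arr _ i => 1 + i.cost
  | add e f => 1 + e.cost + f.cost
  | sub e f => 1 + e.cost + f.cost
  | mul e f => 1 + e.cost + f.cost
  | div e f => 1 + e.cost + f.cost
  | sqrt e => 1 + e.cost

/-- The truth value of a test. -/
def Test.eval (s : Store) : Test → Prop
  | natLe e f => e.eval s ≤ f.eval s
  | realLe e f => e.eval s ≤ f.eval s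
  | neg b => ¬ b.eval s
  | conj b c => b.eval s ∧ c.eval s

/-- The number of operations and memory accesses in a test. -/
def Test.cost : Test → ℕ
  | natLe e f => 1 + e.cost + f.cost
  | realLe e f => 1 + e.cost + f.cost
  | neg b => 1 + b.cost
  | conj b c => 1 + b.cost + c.cost

/-- Programs; `loop b p` is "while `b` do `p`". -/
inductive Program : Type
  | nop
  | setNat (x : ℕ) (e : NatExp)
  | setReal (x : ℕ) (e : RealExp)
  | storeNat (a : ℕ) (i : NatExp) (e : NatExp)
  | storeReal (a : ℕ) (i : NatExp) (e : RealExp)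
  | seq (p q : Program)
  | cond (b : Test) (p q : Program)
  | loop (b : Test) (p : Program)

/-- `Run p s s' t`: started in memory `s`, the program `p` halts after `t` steps in memory `s'`. -/
inductive Run : Program → Store → Store → ℕ → Prop
  | nop (s : Store) : Run .nop s s 1
  | setNat (x : ℕ) (e : NatExp) (s : Store) :
      Run (.setNat x e) s { s with natVar := Function.update s.natVar x (e.eval s) } (1 + e.cost)
  | setReal (x : ℕ) (e : RealExp) (s : Store) :
      Run (.setReal x e) s { s with realVar := Function.update s.realVar x (e.eval s) }
        (1 + e.cost)
  | storeNat (a : ℕ) (i : NatExp) (e : NatExp) (s : Store) :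
      Run (.storeNat a i e) s
        { s with natArr := Function.update s.natArr a
                  (Function.update (s.natArr a) (i.eval s) (e.eval s)) }
        (1 + i.cost + e.cost)
  | storeReal (a : ℕ) (i : NatExp) (e : RealExp) (s : Store) :
      Run (.storeReal a i e) s
        { s with realArr := Function.update s.realArr a
                  (Function.update (s.realArr a) (i.eval s) (e.eval s)) }
        (1 + i.cost + e.cost)
  | seq {p q : Program} {s s' s'' : Store} {t t' : ℕ} :
      Run p s s' t → Run q s' s'' t' → Run (.seq p q) s s'' (t + t')
  | condTrue {b : Test} {p q : Program} {s s' : Store} {t : ℕ} :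
      b.eval s → Run p s s' t → Run (.cond b p q) s s' (1 + b.cost + t)
  | condFalse {b : Test} {p q : Program} {s s' : Store} {t : ℕ} :
      ¬ b.eval s → Run q s s' t → Run (.cond b p q) s s' (1 + b.cost + t)
  | loopStop {b : Test} {p : Program} {s : Store} :
      ¬ b.eval s → Run (.loop b p) s s (1 + b.cost)
  | loopStep {b : Test} {p : Program} {s s' s'' : Store} {t t' : ℕ} :
      b.eval s → Run p s s' t → Run (.loop b p) s' s'' t' →
      Run (.loop b p) s s'' (1 + b.cost + t + t')

/-- The initial memory for `n` clients `Y` and accuracy `ε`: the natural number register `0` holds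
`n`, the real register `0` holds `ε`, the real arrays `0` and `1` hold the first and second
coordinates of the clients, and all other cells hold `0`. -/
noncomputable def input {n : ℕ} (Y : Fin n → Plane) (ε : ℝ) : Store where
  natVar := fun x => if x = 0 then n else 0
  realVar := fun x => if x = 0 then ε else 0
  natArr := fun _ _ => 0
  realArr := fun a i =>
    if h : i < n then
      if a = 0 then Y ⟨i, h⟩ 0 else if a = 1 then Y ⟨i, h⟩ 1 else 0
    else 0

/-- The number of disks that a final memory describes: the content of the natural number
register `1`. -/
def outputSize (s : Store) : ℕ := s.natVar 1

/-- The disks that a final memory describes: the real arrays `2` and `3` hold the coordinates of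
the centers, and the real array `4` holds the radii. -/
noncomputable def output (s : Store) : Fin (outputSize s) → Disk := fun j =>
  { center := !₂[s.realArr 2 j, s.realArr 3 j]
    radius := s.realArr 4 j }

end RealRAM

/-! For a fixed line an optimal cover can be computed in time `O(n^2)`. Two disks that meet on the
line of centers can be replaced by one disk of at most the sum of their radii
(`exists_merged_disk`). Hence, with the clients sorted along the line, it suffices to let each disk
serve a block of consecutive clients, and a dynamic program over the last block is exact
(`IsCoverTable.le_sum`). The smallest disks of all blocks take constant time each: by Helly's
theorem on the line, the disk of a block is the largest among those of its two maximal proper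
sub-blocks and that of its two end points (`IsMinDisk.clientsIcc_succ`).

It remains to try few lines. Let `p` be a client, `p + L u` a client farthest from `p`, and `V` the
cost of some collinear cover. Its line passes within `V` of both clients, so its offset `t` from `p`
satisfies `|t| ≤ V`, and the tangent `s` of half its angle to `u` satisfies `L |s| ≤ 2 V`
(`IsFrame.exists_line`, `exists_rotateHalf_eq`). If `V ≤ L` and `V ≤ g ≤ 2 V`, then rounding `t` and
`L s` to the grid of step `τ = ε g / (10 n)` can be paid for by enlarging each radius by `5 τ`. At
most `n` disks are needed, so the cost grows by at most `5 n τ ≤ ε V` (`IsFrame.exists_grid_line`).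
This leaves `O((n / ε)^2)` lines for each scale `g` when `ε < 4 n`. The half-angle parameter keeps
the directions exact unit vectors that are computed by rational operations.

The scale is found by doubling. Projecting every client to the axis of the frame gives a cover of
cost `S ≤ 4 n V` (`IsFrame.abs_im_le`). If `V ≤ S`, one of the `O(log (n + 1))` values `2^k S / (4
n)` lies in `[V, 2 V]` (`exists_scale`); otherwise the projection is already cheaper than `V`. For
`ε ≥ 4 n` the projection alone is good enough and takes linear time. -/

namespace RealRAM

/-! ### Program logic: running times, Hoare rules and framing -/

instance : Add NatExp := ⟨NatExp.add⟩
instance : Sub NatExp := ⟨NatExp.sub⟩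
instance : Add RealExp := ⟨RealExp.add⟩
instance : Sub RealExp := ⟨RealExp.sub⟩
instance : Mul RealExp := ⟨RealExp.mul⟩
instance : Div RealExp := ⟨RealExp.div⟩

@[simp] theorem NatExp.eval_add (s : Store) (e f : NatExp) :
    (e + f).eval s = e.eval s + f.eval s := rfl
@[simp] theorem NatExp.eval_sub (s : Store) (e f : NatExp) :
    (e - f).eval s = e.eval s - f.eval s := rfl
@[simp] theorem RealExp.eval_add (s : Store) (e f : RealExp) :
    (e + f).eval s = e.eval s + f.eval s := rfl
@[simp] theorem RealExp.eval_sub (s : Store) (e f : RealExp) :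
    (e - f).eval s = e.eval s - f.eval s := rfl
@[simp] theorem RealExp.eval_mul (s : Store) (e f : RealExp) :
    (e * f).eval s = e.eval s * f.eval s := rfl
@[simp] theorem RealExp.eval_div (s : Store) (e f : RealExp) :
    (e / f).eval s = e.eval s / f.eval s := rfl

attribute [simp] NatExp.eval RealExp.eval Test.eval

infixr:65 " ⨟ " => Program.seq

/-- A bound for the running time of a program all of whose loops make at most `B` iterations each
time they are executed. -/
def Program.timeBound (B : ℕ) : Program → ℕ
  | .nop => 1
  | .setNat _ e => 1 + e.cost
  | .setReal _ e => 1 + e.cost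
  | .storeNat _ i e => 1 + i.cost + e.cost
  | .storeReal _ i e => 1 + i.cost + e.cost
  | .seq p q => p.timeBound B + q.timeBound B
  | .cond b p q => 1 + b.cost + (p.timeBound B + q.timeBound B)
  | .loop b p => (B + 1) * (1 + b.cost + p.timeBound B)

/-- The nesting depth of the loops of a program. -/
def Program.depth : Program → ℕ
  | .seq p q => max p.depth q.depth
  | .cond _ p q => max p.depth q.depth
  | .loop _ p => p.depth + 1
  | _ => 0

/-- Each level of loop nesting contributes one factor `B + 1`, so the depth is the degree of the
polynomial time bound. Asymptotic bounds thus follow from the shape of a program, with the constant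
`p.timeBound 0` left unevaluated. -/
theorem Program.timeBound_le (B : ℕ) (p : Program) :
    p.timeBound B ≤ p.timeBound 0 * (B + 1) ^ p.depth := by
  have mono : ∀ {x c d e : ℕ}, d ≤ e → x ≤ c * (B + 1) ^ d → x ≤ c * (B + 1) ^ e :=
    fun hde h => h.trans (Nat.mul_le_mul le_rfl (Nat.pow_le_pow_right (Nat.succ_pos B) hde))
  induction p with
  | nop => simp [timeBound, depth]
  | setNat x e => simp [timeBound, depth]
  | setReal x e => simp [timeBound, depth]
  | storeNat a i e => simp [timeBound, depth]
  | storeReal a i e => simp [timeBound, depth]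
  | seq p q hp hq =>
    have h1 := mono (le_max_left p.depth q.depth) hp
    have h2 := mono (le_max_right p.depth q.depth) hq
    simp only [timeBound, depth, add_mul]
    omega
  | cond b p q hp hq =>
    have h1 := mono (le_max_left p.depth q.depth) hp
    have h2 := mono (le_max_right p.depth q.depth) hq
    have h3 : 1 + b.cost ≤ (1 + b.cost) * (B + 1) ^ max p.depth q.depth :=
      Nat.le_mul_of_pos_right _ (by positivity)
    simp only [timeBound, depth]
    rw [add_mul, add_mul (p.timeBound 0)]
    linarith
  | loop b p hp =>
    have h3 : 1 + b.cost ≤ (1 + b.cost) * (B + 1) ^ p.depth :=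
      Nat.le_mul_of_pos_right _ (by positivity)
    simp only [timeBound, depth]
    calc (B + 1) * (1 + b.cost + p.timeBound B)
        ≤ (B + 1) * ((1 + b.cost) * (B + 1) ^ p.depth + p.timeBound 0 * (B + 1) ^ p.depth) :=
          Nat.mul_le_mul le_rfl (add_le_add h3 hp)
      _ = (0 + 1) * (1 + b.cost + p.timeBound 0) * (B + 1) ^ (p.depth + 1) := by ring

/-- Started in `s`, the program `p` halts within `T` steps in a memory with the property `Q`. -/
def EndsIn (T : ℕ) (p : Program) (s : Store) (Q : Store → Prop) : Prop :=
  ∃ s' t, Run p s s' t ∧ t ≤ T ∧ Q s'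

/-- Started in `s`, the program `p` halts in a memory with the property `Q`, and in such time as
if no loop made more than `B` iterations. -/
def Ends (B : ℕ) (p : Program) (s : Store) (Q : Store → Prop) : Prop :=
  EndsIn (p.timeBound B) p s Q

section rules
variable {T T' B : ℕ} {p q : Program} {b : Test} {s : Store} {Q R : Store → Prop}

theorem EndsIn.mono (h : EndsIn T p s Q) (hT : T ≤ T') (hQ : ∀ s', Q s' → R s') :
    EndsIn T' p s R := by
  obtain ⟨s', t, h1, h2, h3⟩ := h
  exact ⟨s', t, h1, h2.trans hT, hQ _ h3⟩

theorem Ends.mono (h : Ends B p s Q) (hQ : ∀ s', Q s' → R s') : Ends B p s R :=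
  EndsIn.mono h le_rfl hQ

theorem EndsIn.seq (h : EndsIn T p s fun s' => EndsIn T' q s' Q) : EndsIn (T + T') (p ⨟ q) s Q := by
  obtain ⟨s', t, h1, h2, s'', t', h3, h4, h5⟩ := h
  exact ⟨s'', t + t', .seq h1 h3, add_le_add h2 h4, h5⟩

theorem Ends.seq (h : Ends B p s fun s' => Ends B q s' Q) : Ends B (p ⨟ q) s Q :=
  EndsIn.seq h

theorem EndsIn.cond (h : b.eval s → EndsIn T p s Q) (h' : ¬ b.eval s → EndsIn T' q s Q) :
    EndsIn (1 + b.cost + (T + T')) (.cond b p q) s Q := by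
  by_cases hb : b.eval s
  · obtain ⟨s', t, h1, h2, h3⟩ := h hb
    exact ⟨s', _, .condTrue hb h1, by omega, h3⟩
  · obtain ⟨s', t, h1, h2, h3⟩ := h' hb
    exact ⟨s', _, .condFalse hb h1, by omega, h3⟩

theorem Ends.cond (h : b.eval s → Ends B p s Q) (h' : ¬ b.eval s → Ends B q s Q) :
    Ends B (.cond b p q) s Q :=
  EndsIn.cond h h'

/-- The invariant is indexed by the number of completed iterations, and `step` must show that the
test can succeed only while this number is below `N`; this gives termination and the time bound
together. -/
theorem EndsIn.loop (I : ℕ → Store → Prop) (N : ℕ) (h0 : I 0 s)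
    (step : ∀ k s, I k s → b.eval s → k < N ∧ EndsIn T p s (I (k + 1))) :
    EndsIn ((N + 1) * (1 + b.cost + T)) (.loop b p) s fun s' => ∃ k, I k s' ∧ ¬ b.eval s' := by
  -- Induction on the number `m` of iterations that may still happen.
  suffices H : ∀ m k s, I k s → N ≤ k + m →
      EndsIn ((m + 1) * (1 + b.cost + T)) (.loop b p) s fun s' => ∃ k, I k s' ∧ ¬ b.eval s' from
    H N 0 s h0 (by omega)
  intro m
  induction m with
  | zero =>
    intro k s hk hN
    by_cases hb : b.eval s
    · have := (step k s hk hb).1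
      omega
    · exact ⟨s, _, .loopStop hb, by omega, k, hk, hb⟩
  | succ m ih =>
    intro k s hk hN
    by_cases hb : b.eval s
    · obtain ⟨s', t, h1, h2, h3⟩ := (step k s hk hb).2
      obtain ⟨s'', t', h4, h5, h6⟩ := ih (k + 1) s' h3 (by omega)
      exact ⟨s'', _, .loopStep hb h1 h4, by linarith [add_mul (m + 1) 1 (1 + b.cost + T)], h6⟩
    · refine ⟨s, _, .loopStop hb, ?_, k, hk, hb⟩
      nlinarith [Nat.zero_le T, Nat.zero_le (m * (1 + b.cost + T)),
        Nat.zero_le ((m + 1) * (1 + b.cost + T))]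

theorem Ends.loop (I : ℕ → Store → Prop) (h0 : I 0 s)
    (step : ∀ k s, I k s → b.eval s → k < B ∧ Ends B p s (I (k + 1))) :
    Ends B (.loop b p) s fun s' => ∃ k, I k s' ∧ ¬ b.eval s' :=
  EndsIn.loop I B h0 step

end rules

/-- The weakest precondition of a program without loops. -/
def Program.wp (Q : Store → Prop) : Program → Store → Prop
  | .nop, s => Q s
  | .setNat x e, s => Q { s with natVar := Function.update s.natVar x (e.eval s) }
  | .setReal x e, s => Q { s with realVar := Function.update s.realVar x (e.eval s) }
  | .storeNat a i e, s =>
      Q { s with natArr := Function.update s.natArr a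
                  (Function.update (s.natArr a) (i.eval s) (e.eval s)) }
  | .storeReal a i e, s =>
      Q { s with realArr := Function.update s.realArr a
                  (Function.update (s.realArr a) (i.eval s) (e.eval s)) }
  | .seq p q, s => p.wp (q.wp Q) s
  | .cond b p q, s => (b.eval s → p.wp Q s) ∧ (¬ b.eval s → q.wp Q s)
  | .loop _ _, _ => False

theorem Ends.of_wp {B : ℕ} {p : Program} {s : Store} {Q : Store → Prop} (h : p.wp Q s) :
    Ends B p s Q := by
  induction p generalizing s Q with
  | nop => exact ⟨_, _, .nop s, le_rfl, h⟩
  | setNat x e => exact ⟨_, _, .setNat x e s, le_rfl, h⟩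
  | setReal x e => exact ⟨_, _, .setReal x e s, le_rfl, h⟩
  | storeNat a i e => exact ⟨_, _, .storeNat a i e s, le_rfl, h⟩
  | storeReal a i e => exact ⟨_, _, .storeReal a i e s, le_rfl, h⟩
  | seq p q hp hq => exact Ends.seq (hp (Q := fun s' => Ends B q s' Q) <| by
      have mono : ∀ (p : Program) (s : Store) (Q R : Store → Prop), (∀ s, Q s → R s) →
          p.wp Q s → p.wp R s := by
        intro p
        induction p with
        | seq p q hp hq => exact fun s Q R h => hp s _ _ fun s' => hq s' _ _ h
        | cond b p q hp hq =>
          exact fun s Q R h h' => ⟨fun hb => hp s Q R h (h'.1 hb), fun hb => hq s Q R h (h'.2 hb)⟩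
        | loop b p hp => exact fun s Q R h h' => h'
        | _ => exact fun s Q R h h' => h _ h'
      exact mono p s _ _ (fun s' hs' => hq hs') h)
  | cond b p q hp hq => exact Ends.cond (fun hb => hp (h.1 hb)) (fun hb => hq (h.2 hb))
  | loop b p hp => exact h.elim

/-- Does the program assign to this natural number register? -/
def Program.writesNat (x : ℕ) : Program → Bool
  | .setNat y _ => y == x
  | .seq p q => p.writesNat x || q.writesNat x
  | .cond _ p q => p.writesNat x || q.writesNat x
  | .loop _ p => p.writesNat x
  | _ => false

/-- Does the program assign to this real register? -/
def Program.writesReal (x : ℕ) : Program → Bool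
  | .setReal y _ => y == x
  | .seq p q => p.writesReal x || q.writesReal x
  | .cond _ p q => p.writesReal x || q.writesReal x
  | .loop _ p => p.writesReal x
  | _ => false

/-- Does the program assign to this array of natural numbers? -/
def Program.writesNatArr (x : ℕ) : Program → Bool
  | .storeNat y _ _ => y == x
  | .seq p q => p.writesNatArr x || q.writesNatArr x
  | .cond _ p q => p.writesNatArr x || q.writesNatArr x
  | .loop _ p => p.writesNatArr x
  | _ => false

/-- Does the program assign to this array of reals? -/
def Program.writesRealArr (x : ℕ) : Program → Bool
  | .storeReal y _ _ => y == x
  | .seq p q => p.writesRealArr x || q.writesRealArr x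
  | .cond _ p q => p.writesRealArr x || q.writesRealArr x
  | .loop _ p => p.writesRealArr x
  | _ => false

/-- The two memories agree on everything to which `p` does not assign. -/
structure Same (p : Program) (s s' : Store) : Prop where
  nat : ∀ x, p.writesNat x = false → s'.natVar x = s.natVar x
  real : ∀ x, p.writesReal x = false → s'.realVar x = s.realVar x
  natArr : ∀ x, p.writesNatArr x = false → s'.natArr x = s.natArr x
  realArr : ∀ x, p.writesRealArr x = false → s'.realArr x = s.realArr x

/-- The frame rule. Whether a program writes to a given cell is decided by its syntax, so `rfl`
proves that a register or array is preserved, and specifications need only mention what changes. -/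
theorem Run.same {p : Program} {s s' : Store} {t : ℕ} (h : Run p s s' t) : Same p s s' := by
  induction h with
  | nop s => exact ⟨fun _ _ => rfl, fun _ _ => rfl, fun _ _ => rfl, fun _ _ => rfl⟩
  | setNat x e s =>
    refine ⟨fun y hy => ?_, fun _ _ => rfl, fun _ _ => rfl, fun _ _ => rfl⟩
    have : x ≠ y := by simpa [Program.writesNat] using hy
    exact Function.update_of_ne this.symm _ _
  | setReal x e s =>
    refine ⟨fun _ _ => rfl, fun y hy => ?_, fun _ _ => rfl, fun _ _ => rfl⟩
    have : x ≠ y := by simpa [Program.writesReal] using hy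
    exact Function.update_of_ne this.symm _ _
  | storeNat a i e s =>
    refine ⟨fun _ _ => rfl, fun _ _ => rfl, fun y hy => ?_, fun _ _ => rfl⟩
    have : a ≠ y := by simpa [Program.writesNatArr] using hy
    exact Function.update_of_ne this.symm _ _
  | storeReal a i e s =>
    refine ⟨fun _ _ => rfl, fun _ _ => rfl, fun _ _ => rfl, fun y hy => ?_⟩
    have : a ≠ y := by simpa [Program.writesRealArr] using hy
    exact Function.update_of_ne this.symm _ _
  | seq _ _ h1 h2 =>
    constructor <;> intro x hx
    · have := Bool.or_eq_false_iff.1 hx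
      exact (h2.nat x this.2).trans (h1.nat x this.1)
    · have := Bool.or_eq_false_iff.1 hx
      exact (h2.real x this.2).trans (h1.real x this.1)
    · have := Bool.or_eq_false_iff.1 hx
      exact (h2.natArr x this.2).trans (h1.natArr x this.1)
    · have := Bool.or_eq_false_iff.1 hx
      exact (h2.realArr x this.2).trans (h1.realArr x this.1)
  | condTrue _ _ h =>
    exact ⟨fun x hx => h.nat x (Bool.or_eq_false_iff.1 hx).1,
      fun x hx => h.real x (Bool.or_eq_false_iff.1 hx).1,
      fun x hx => h.natArr x (Bool.or_eq_false_iff.1 hx).1,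
      fun x hx => h.realArr x (Bool.or_eq_false_iff.1 hx).1⟩
  | condFalse _ _ h =>
    exact ⟨fun x hx => h.nat x (Bool.or_eq_false_iff.1 hx).2,
      fun x hx => h.real x (Bool.or_eq_false_iff.1 hx).2,
      fun x hx => h.natArr x (Bool.or_eq_false_iff.1 hx).2,
      fun x hx => h.realArr x (Bool.or_eq_false_iff.1 hx).2⟩
  | loopStop _ => exact ⟨fun _ _ => rfl, fun _ _ => rfl, fun _ _ => rfl, fun _ _ => rfl⟩
  | loopStep _ _ _ h1 h2 =>
    exact ⟨fun x hx => (h2.nat x hx).trans (h1.nat x hx),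
      fun x hx => (h2.real x hx).trans (h1.real x hx),
      fun x hx => (h2.natArr x hx).trans (h1.natArr x hx),
      fun x hx => (h2.realArr x hx).trans (h1.realArr x hx)⟩

theorem EndsIn.same {T : ℕ} {p : Program} {s : Store} {Q : Store → Prop} (h : EndsIn T p s Q) :
    EndsIn T p s fun s' => Q s' ∧ Same p s s' := by
  obtain ⟨s', t, h1, h2, h3⟩ := h
  exact ⟨s', t, h1, h2, h3, h1.same⟩

theorem Ends.same {B : ℕ} {p : Program} {s : Store} {Q : Store → Prop} (h : Ends B p s Q) :
    Ends B p s fun s' => Q s' ∧ Same p s s' :=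
  EndsIn.same h

/-- Run `p` for the values `0, 1, ..., e - 1` of the register `i`. -/
def forLoop (i : ℕ) (e : NatExp) (p : Program) : Program :=
  .setNat i (.lit 0) ⨟
  .loop (.neg (.natLe e (.var i))) (p ⨟ .setNat i (.var i + .lit 1))

/-- The rule for `forLoop`: the invariant may depend on everything but on the loop register. -/
theorem Ends.forLoop {B N i : ℕ} {e : NatExp} {p : Program} {s : Store}
    (I : ℕ → Store → Prop) (hN : N ≤ B)
    (hI : ∀ k s v, I k s → I k { s with natVar := Function.update s.natVar i v })
    (he : ∀ k s, I k s → e.eval s = N) (h0 : I 0 s) (hi : p.writesNat i = false)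
    (step : ∀ k s, k < N → s.natVar i = k → I k s → Ends B p s (I (k + 1))) :
    Ends B (forLoop i e p) s (I N) := by
  refine Ends.seq (Ends.of_wp ?_)
  refine (Ends.loop (fun k s => I k s ∧ s.natVar i = k ∧ k ≤ N) ?_ ?_).mono ?_
  · exact ⟨hI _ _ _ h0, by simp, Nat.zero_le _⟩
  · rintro k s ⟨hk, hik, hkN⟩ hb
    have hlt : k < N := by
      have : ¬ e.eval s ≤ s.natVar i := hb
      rw [he k s hk] at this
      omega
    refine ⟨by omega, Ends.seq ((step k s hlt hik hk).same.mono ?_)⟩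
    rintro s' ⟨h1, h2⟩
    have h3 : s'.natVar i = k := (h2.nat i hi).trans hik
    exact Ends.of_wp ⟨hI _ _ _ h1, by simp [h3], hlt⟩
  · rintro s' ⟨k, ⟨hk, hik, hkN⟩, hb⟩
    have : e.eval s' ≤ s'.natVar i := not_not.1 hb
    rw [he k s' hk, hik] at this
    rwa [le_antisymm this hkN]

end RealRAM

/-! ### Covering points of the plane by disks centered on the first axis -/

/-- The disk with center `(c, 0)` and radius `r` contains the point `a`. -/
def AxisCovers (c r : ℝ) (a : ℝ × ℝ) : Prop := (a.1 - c) ^ 2 + a.2 ^ 2 ≤ r ^ 2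

/-- The disk with center `(c, 0)` and radius `r` is the unique smallest one centered on the first
axis that contains `A`. -/
structure IsMinDisk (A : Set (ℝ × ℝ)) (c r : ℝ) : Prop where
  nonneg : 0 ≤ r
  covers : ∀ a ∈ A, AxisCovers c r a
  le : ∀ c' r', 0 ≤ r' → (∀ a ∈ A, AxisCovers c' r' a) → r ≤ r'
  unique : ∀ c', (∀ a ∈ A, AxisCovers c' r a) → c' = c

theorem AxisCovers.mono {c r r' : ℝ} {a : ℝ × ℝ} (h : AxisCovers c r a) (h0 : 0 ≤ r)
    (hr : r ≤ r') : AxisCovers c r' a :=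
  le_trans (b := r ^ 2) h (by gcongr)

/-- Convexity: for fixed `r`, the admissible centers for a point form an interval. This is what
makes the one-dimensional Helly theorem applicable. -/
theorem AxisCovers.between {c c' x r : ℝ} {a : ℝ × ℝ} (h : AxisCovers c r a)
    (h' : AxisCovers c' r a) (h1 : c ≤ x) (h2 : x ≤ c') : AxisCovers x r a := by
  unfold AxisCovers at *
  rcases le_total x a.1 with hx | hx
  · nlinarith [mul_nonneg (sub_nonneg.2 h1) (sub_nonneg.2 hx)]
  · nlinarith [mul_nonneg (sub_nonneg.2 h2) (sub_nonneg.2 hx)]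

/-- The one-dimensional Helly theorem for three sets. -/
theorem helly_three (I J K : Set ℝ) [I.OrdConnected] [J.OrdConnected] [K.OrdConnected]
    {x y z : ℝ} (hx : x ∈ I ∩ J) (hy : y ∈ J ∩ K) (hz : z ∈ K ∩ I) : ∃ c, c ∈ I ∧ c ∈ J ∧ c ∈ K := by
  have mem : ∀ (A : Set ℝ) [A.OrdConnected] {u v w : ℝ}, u ∈ A → v ∈ A → w ∈ Set.uIcc u v →
      w ∈ A := fun A _ u v w hu hv hw => Set.OrdConnected.uIcc_subset ‹_› hu hv hw
  by_cases h1 : x ∈ Set.uIcc y z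
  · exact ⟨x, hx.1, hx.2, mem K hy.2 hz.1 h1⟩
  by_cases h2 : y ∈ Set.uIcc x z
  · exact ⟨y, mem I hx.1 hz.2 h2, hy.1, hy.2⟩
  refine ⟨z, hz.2, mem J hx.2 hy.1 ?_, hz.1⟩
  simp only [Set.mem_uIcc, not_or, not_and_or, not_le] at h1 h2 ⊢
  grind

/-- At the largest radius `r` of the three disks, the intervals of admissible centers for `M`, `{a}`
and `{b}` meet pairwise, so they have a common point. The disk that attains `r` has only one
possible center, which must be that point. -/
theorem IsMinDisk.insert_insert {M : Set (ℝ × ℝ)} {a b : ℝ × ℝ} {c₁ r₁ c₂ r₂ c₃ r₃ c r : ℝ}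
    (h₁ : IsMinDisk (insert a M) c₁ r₁) (h₂ : IsMinDisk (insert b M) c₂ r₂)
    (h₃ : IsMinDisk {a, b} c₃ r₃) (hr₁ : r₁ ≤ r) (hr₂ : r₂ ≤ r) (hr₃ : r₃ ≤ r)
    (h : c = c₁ ∧ r = r₁ ∨ c = c₂ ∧ r = r₂ ∨ c = c₃ ∧ r = r₃) :
    IsMinDisk (insert a (insert b M)) c r := by
  let I (A : Set (ℝ × ℝ)) : Set ℝ := {x | ∀ p ∈ A, AxisCovers x r p}
  have hI : ∀ A, (I A).OrdConnected := fun A =>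
    ⟨fun x hx y hy z hz p hp => (hx p hp).between (hy p hp) hz.1 hz.2⟩
  have := hI M
  have := hI {a}
  have := hI {b}
  obtain ⟨x, hxM, hxa, hxb⟩ : ∃ x, x ∈ I M ∧ x ∈ I {a} ∧ x ∈ I {b} := by
    refine helly_three _ _ _ (x := c₁) (y := c₃) (z := c₂) ⟨?_, ?_⟩ ⟨?_, ?_⟩ ⟨?_, ?_⟩ <;>
      intro p hp
    · exact (h₁.covers p (.inr hp)).mono h₁.nonneg hr₁
    · exact (h₁.covers p (.inl hp)).mono h₁.nonneg hr₁
    · exact (h₃.covers p (.inl hp)).mono h₃.nonneg hr₃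
    · exact (h₃.covers p (.inr hp)).mono h₃.nonneg hr₃
    · exact (h₂.covers p (.inl hp)).mono h₂.nonneg hr₂
    · exact (h₂.covers p (.inr hp)).mono h₂.nonneg hr₂
  have hx : ∀ p ∈ insert a (insert b M), AxisCovers x r p := by
    rintro p (rfl | rfl | hp)
    · exact hxa _ rfl
    · exact hxb _ rfl
    · exact hxM _ hp
  have sub₁ : insert a M ⊆ insert a (insert b M) :=
    Set.insert_subset_insert (Set.subset_insert _ _)
  have sub₂ : insert b M ⊆ insert a (insert b M) := Set.subset_insert _ _
  have sub₃ : ({a, b} : Set (ℝ × ℝ)) ⊆ insert a (insert b M) :=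
    Set.insert_subset_insert (by simp)
  have key : ∀ A c r, IsMinDisk A c r → A ⊆ insert a (insert b M) →
      (∀ p ∈ insert a (insert b M), AxisCovers x r p) →
      IsMinDisk (insert a (insert b M)) c r := by
    intro A c r hA hs hx
    obtain rfl : x = c := hA.unique x fun p hp => hx p (hs hp)
    exact ⟨hA.nonneg, hx, fun c' r' h0 h' => hA.le c' r' h0 fun p hp => h' p (hs hp),
      fun c' h' => hA.unique c' fun p hp => h' p (hs hp)⟩
  rcases h with ⟨rfl, rfl⟩ | ⟨rfl, rfl⟩ | ⟨rfl, rfl⟩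
  · exact key _ _ _ h₁ sub₁ hx
  · exact key _ _ _ h₂ sub₂ hx
  · exact key _ _ _ h₃ sub₃ hx

/-- The smallest disk centered on the first axis that contains two points. -/
theorem isMinDisk_pair {a b : ℝ × ℝ} (hab : a.1 ≤ b.1) {c r : ℝ}
    (hc : c = max a.1 (min b.1
      ((b.1 * b.1 + b.2 * b.2 - (a.1 * a.1 + a.2 * a.2)) / (2 * (b.1 - a.1)))))
    (hr : 0 ≤ r) (hra : AxisCovers c r a) (hrb : AxisCovers c r b)
    (hr' : (a.1 - c) ^ 2 + a.2 ^ 2 = r ^ 2 ∨ (b.1 - c) ^ 2 + b.2 ^ 2 = r ^ 2) :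
    IsMinDisk {a, b} c r := by
  obtain ⟨a, y⟩ := a
  obtain ⟨b, z⟩ := b
  simp only [AxisCovers] at *
  -- Every other center is farther from one of the points.
  have key : ∀ c', c' ≠ c → r ^ 2 < (a - c') ^ 2 + y ^ 2 ∨ r ^ 2 < (b - c') ^ 2 + z ^ 2 := by
    intro c' hc'
    rcases eq_or_lt_of_le hab with rfl | hlt
    -- The division by zero returns `0`, and clamping to the one-point interval `[a, a]` still gives
    -- the right center.
    · have : c = a := by rw [hc]; simp
      subst this
      have : 0 < (c - c') ^ 2 := by
        have := sub_ne_zero.2 hc'.symm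
        positivity
      rcases hr' with h | h
      · left; nlinarith
      · right; nlinarith
    -- `e` is where the perpendicular bisector of the two points meets the axis. If it lies outside
    -- `[a, b]`, the center is the foot of the point that determines the radius.
    · set e := (b * b + z * z - (a * a + y * y)) / (2 * (b - a)) with he
      have he' : e * (2 * (b - a)) = b * b + z * z - (a * a + y * y) :=
        div_mul_cancel₀ _ (by nlinarith)
      have hsq : 0 < (c - c') ^ 2 := by
        have := sub_ne_zero.2 hc'.symm
        positivity
      rcases le_or_gt e a with h1 | h1
      · have : c = a := by rw [hc, min_eq_right (h1.trans hab), max_eq_left h1]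
        subst this
        have hge : (b - c) ^ 2 + z ^ 2 ≤ (c - c) ^ 2 + y ^ 2 := by nlinarith
        left
        rcases hr' with h | h <;> nlinarith
      rcases le_or_gt b e with h2 | h2
      · have : c = b := by rw [hc, min_eq_left h2, max_eq_right hab]
        subst this
        have hge : (a - c) ^ 2 + y ^ 2 ≤ (c - c) ^ 2 + z ^ 2 := by nlinarith
        right
        rcases hr' with h | h <;> nlinarith
      · have : c = e := by rw [hc, min_eq_right h2.le, max_eq_right h1.le]
        rw [← this] at h1 h2 he'
        have heq : (a - c) ^ 2 + y ^ 2 = (b - c) ^ 2 + z ^ 2 := by nlinarith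
        rcases lt_or_gt_of_ne hc' with h3 | h3
        · right
          have := mul_pos (sub_pos.2 h3) (sub_pos.2 h2)
          rcases hr' with h | h <;> nlinarith
        · left
          have := mul_pos (sub_pos.2 h3) (sub_pos.2 h1)
          rcases hr' with h | h <;> nlinarith
  refine ⟨hr, ?_, ?_, ?_⟩
  · rintro p (rfl | rfl)
    · exact hra
    · exact hrb
  · intro c' r' h0 h
    have h1 := h (a, y) (.inl rfl)
    have h2 := h (b, z) (.inr rfl)
    simp only [AxisCovers] at h1 h2
    by_contra! hlt
    have hlt2 : r' ^ 2 < r ^ 2 := by gcongr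
    by_cases hc' : c' = c
    · subst hc'
      rcases hr' with h | h <;> linarith
    · rcases key c' hc' with h | h <;> linarith
  · intro c' h
    have h1 := h (a, y) (.inl rfl)
    have h2 := h (b, z) (.inr rfl)
    simp only [AxisCovers] at h1 h2
    by_contra hc'
    rcases key c' hc' with h | h <;> linarith

/-- The entry for the first `j + 1` points in the table of the dynamic program: a best one among
those covers whose last disk contains exactly the points from some `i` with `j < i + k` on. -/
structure IsCoverRow (X Z : ℕ → ℝ) (j k : ℕ) (prev : ℕ → ℕ) (F c r : ℕ → ℝ) : Prop where
  prev_le : prev (j + 1) ≤ j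
  nonneg : 0 ≤ r (j + 1)
  covers : ∀ l, prev (j + 1) ≤ l → l ≤ j → AxisCovers (c (j + 1)) (r (j + 1)) (X l, Z l)
  eq : F (j + 1) = F (prev (j + 1)) + r (j + 1)
  le : ∀ i ≤ j, j < i + k → ∀ c' r', 0 ≤ r' →
    (∀ l, i ≤ l → l ≤ j → AxisCovers c' r' (X l, Z l)) → F (j + 1) ≤ F i + r'

/-- The result of the dynamic program for the points `(X k, Z k)`, `k < n`, which are sorted by
their first coordinates: `F j` is the least cost of a cover of the first `j` points, whose last
disk has center `c j` and radius `r j` and contains the points from `prev j` on. -/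
structure IsCoverTable (n : ℕ) (X Z : ℕ → ℝ) (prev : ℕ → ℕ) (F c r : ℕ → ℝ) : Prop where
  zero : F 0 = 0
  row : ∀ j < n, IsCoverRow X Z j (j + 1) prev F c r

theorem IsCoverRow.congr {X Z : ℕ → ℝ} {j k : ℕ} {prev prev' : ℕ → ℕ} {F c r F' c' r' : ℕ → ℝ}
    (h : IsCoverRow X Z j k prev F c r) (h1 : prev' (j + 1) = prev (j + 1))
    (h2 : ∀ i ≤ j + 1, F' i = F i) (h3 : c' (j + 1) = c (j + 1)) (h4 : r' (j + 1) = r (j + 1)) :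
    IsCoverRow X Z j k prev' F' c' r' where
  prev_le := h1 ▸ h.prev_le
  nonneg := h4 ▸ h.nonneg
  covers := by rw [h1, h3, h4]; exact h.covers
  eq := by rw [h1, h4, h2 _ le_rfl, h2 _ (h.prev_le.trans (Nat.le_succ j))]; exact h.eq
  le := by
    intro i hi
    rw [h2 _ le_rfl, h2 i (by omega)]
    exact h.le i hi

theorem IsCoverTable.update {X Z : ℕ → ℝ} {j : ℕ} {prev : ℕ → ℕ} {F c r : ℕ → ℝ}
    (h : IsCoverTable j X Z prev F c r) (i : ℕ) (x y z : ℝ) :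
    IsCoverTable j X Z (Function.update prev (j + 1) i) (Function.update F (j + 1) x)
      (Function.update c (j + 1) y) (Function.update r (j + 1) z) where
  zero := by simp [h.zero]
  row := fun l hl => (h.row l hl).congr (by simp [hl.ne])
    (fun i hi => by simp [show i ≠ j + 1 by omega]) (by simp [hl.ne]) (by simp [hl.ne])

theorem IsCoverTable.succ {X Z : ℕ → ℝ} {j : ℕ} {prev : ℕ → ℕ} {F c r : ℕ → ℝ}
    (h : IsCoverTable j X Z prev F c r) (h' : IsCoverRow X Z j (j + 1) prev F c r) :
    IsCoverTable (j + 1) X Z prev F c r where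
  zero := h.zero
  row := fun l hl => by
    rcases eq_or_lt_of_le (Nat.le_of_lt_succ hl) with rfl | hl
    · exact h'
    · exact h.row l hl

/-- The points with the indices `i, ..., j`. -/
def clientsIcc (X Z : ℕ → ℝ) (i j : ℕ) : Set (ℝ × ℝ) := {a | ∃ k, i ≤ k ∧ k ≤ j ∧ a = (X k, Z k)}

theorem clientsIcc_self (X Z : ℕ → ℝ) (i : ℕ) : clientsIcc X Z i i = {(X i, Z i)} := by
  ext a
  constructor
  · rintro ⟨k, h1, h2, rfl⟩
    rw [le_antisymm h1 h2]
    rfl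
  · rintro rfl
    exact ⟨i, le_rfl, le_rfl, rfl⟩

theorem clientsIcc_eq_insert_left (X Z : ℕ → ℝ) {i j : ℕ} (h : i ≤ j) :
    clientsIcc X Z i j = insert (X i, Z i) (clientsIcc X Z (i + 1) j) := by
  ext a
  constructor
  · rintro ⟨k, h1, h2, rfl⟩
    rcases eq_or_lt_of_le h1 with rfl | h1
    · exact .inl rfl
    · exact .inr ⟨k, h1, h2, rfl⟩
  · rintro (rfl | ⟨k, h1, h2, rfl⟩)
    · exact ⟨i, le_rfl, h, rfl⟩
    · exact ⟨k, by omega, h2, rfl⟩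

theorem clientsIcc_eq_insert_right (X Z : ℕ → ℝ) {i j : ℕ} (h : i ≤ j + 1) :
    clientsIcc X Z i (j + 1) = insert (X (j + 1), Z (j + 1)) (clientsIcc X Z i j) := by
  ext a
  constructor
  · rintro ⟨k, h1, h2, rfl⟩
    rcases eq_or_lt_of_le h2 with rfl | h2
    · exact .inl rfl
    · exact .inr ⟨k, h1, by omega, rfl⟩
  · rintro (rfl | ⟨k, h1, h2, rfl⟩)
    · exact ⟨j + 1, h, le_rfl, rfl⟩
    · exact ⟨k, h1, by omega, rfl⟩

/-- The smallest disk of a segment is the largest one among those of its two maximal proper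
subsegments and that of its end points. -/
theorem IsMinDisk.clientsIcc_succ {X Z : ℕ → ℝ} {i j : ℕ} (h : i ≤ j) {c₁ r₁ c₂ r₂ c₃ r₃ c r : ℝ}
    (h₁ : IsMinDisk (clientsIcc X Z i j) c₁ r₁) (h₂ : IsMinDisk (clientsIcc X Z (i + 1) (j + 1)) c₂ r₂)
    (h₃ : IsMinDisk {(X i, Z i), (X (j + 1), Z (j + 1))} c₃ r₃)
    (hr₁ : r₁ ≤ r) (hr₂ : r₂ ≤ r) (hr₃ : r₃ ≤ r)
    (hc : c = c₁ ∧ r = r₁ ∨ c = c₂ ∧ r = r₂ ∨ c = c₃ ∧ r = r₃) :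
    IsMinDisk (clientsIcc X Z i (j + 1)) c r := by
  rw [clientsIcc_eq_insert_left X Z (by omega), clientsIcc_eq_insert_right X Z (by omega)]
  rw [clientsIcc_eq_insert_left X Z h] at h₁
  rw [clientsIcc_eq_insert_right X Z (by omega)] at h₂
  exact h₁.insert_insert h₂ h₃ hr₁ hr₂ hr₃ hc

/-- The candidate `i = j - k` for the start of the last block replaces the current best one. For `k
= 0` no comparison is required, since the entry `j + 1` may still hold an arbitrary value. -/
theorem IsCoverRow.step_update {X Z : ℕ → ℝ} {i j k : ℕ} {prev : ℕ → ℕ} {F C R : ℕ → ℝ} {c r : ℝ}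
    (hi : i + k = j) (hd : IsMinDisk (clientsIcc X Z i j) c r)
    (h : 1 ≤ k → IsCoverRow X Z j k prev F C R) (hk : k = 0 ∨ F i + r ≤ F (j + 1)) :
    IsCoverRow X Z j (k + 1) (Function.update prev (j + 1) i)
      (Function.update F (j + 1) (F i + r)) (Function.update C (j + 1) c)
      (Function.update R (j + 1) r) where
  prev_le := by simp; omega
  nonneg := by simpa using hd.nonneg
  covers := by
    simp only [Function.update_self]
    exact fun l h1 h2 => hd.covers _ ⟨l, h1, h2, rfl⟩
  eq := by simp [show i ≠ j + 1 by omega]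
  le := by
    intro l hl hlk c' r' hr' hcov
    simp only [Function.update_self, Function.update_of_ne (show l ≠ j + 1 by omega)]
    rcases eq_or_lt_of_le (show i ≤ l by omega) with rfl | hil
    · have := hd.le c' r' hr' (by rintro _ ⟨m, h1, h2, rfl⟩; exact hcov m h1 h2)
      linarith
    · rcases hk with rfl | hk
      · omega
      · exact hk.trans ((h (by omega)).le l hl (by omega) c' r' hr' hcov)

theorem IsCoverRow.step {X Z : ℕ → ℝ} {i j k : ℕ} {prev : ℕ → ℕ} {F C R : ℕ → ℝ} {c r : ℝ}
    (hi : i + k = j) (hd : IsMinDisk (clientsIcc X Z i j) c r)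
    (h : IsCoverRow X Z j k prev F C R) (hk : F (j + 1) ≤ F i + r) :
    IsCoverRow X Z j (k + 1) prev F C R where
  prev_le := h.prev_le
  nonneg := h.nonneg
  covers := h.covers
  eq := h.eq
  le := by
    intro l hl hlk c' r' hr' hcov
    rcases eq_or_lt_of_le (show i ≤ l by omega) with rfl | hil
    · have := hd.le c' r' hr' (by rintro _ ⟨m, h1, h2, rfl⟩; exact hcov m h1 h2)
      linarith
    · exact h.le l hl (by omega) c' r' hr' hcov

/-- Two disks that are centered on the first axis and overlap there are contained in a third such
disk, of at most the sum of their radii. -/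
theorem exists_merged_disk {c r c' r' x : ℝ} (h0 : 0 ≤ r) (h0' : 0 ≤ r') (h : |x - c| ≤ r)
    (h' : |x - c'| ≤ r') :
    ∃ c'' r'', 0 ≤ r'' ∧ r'' ≤ r + r' ∧
      ∀ a, AxisCovers c r a ∨ AxisCovers c' r' a → AxisCovers c'' r'' a := by
  -- The triangle inequality for disks, in squared form.
  have incl : ∀ {u s u' s' : ℝ}, 0 ≤ s → |u - u'| + s ≤ s' → ∀ a : ℝ × ℝ, AxisCovers u s a →
      AxisCovers u' s' a := by
    intro u s u' s' hs hus a ha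
    unfold AxisCovers at *
    have h1 : |a.1 - u| ≤ s := abs_le_of_sq_le_sq (by nlinarith [sq_nonneg a.2]) hs
    have h2 : (a.1 - u) * (u - u') ≤ s * |u - u'| := by
      calc _ ≤ |(a.1 - u) * (u - u')| := le_abs_self _
        _ = |a.1 - u| * |u - u'| := abs_mul _ _
        _ ≤ _ := by gcongr
    have h3 : (|u - u'| + s) ^ 2 ≤ s' ^ 2 := by gcongr
    nlinarith [sq_abs (u - u')]
  -- `[A, B]` is the convex hull of the two intersections with the axis.
  obtain ⟨A, hA⟩ : ∃ A, A = min (c - r) (c' - r') := ⟨_, rfl⟩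
  obtain ⟨B, hB⟩ : ∃ B, B = max (c + r) (c' + r') := ⟨_, rfl⟩
  rw [abs_le] at h h'
  have hA1 : A ≤ c - r := hA ▸ min_le_left _ _
  have hA2 : A ≤ c' - r' := hA ▸ min_le_right _ _
  have hB1 : c + r ≤ B := hB ▸ le_max_left _ _
  have hB2 : c' + r' ≤ B := hB ▸ le_max_right _ _
  have hAB : B - A ≤ 2 * (r + r') := by
    rcases min_choice (c - r) (c' - r') with h1 | h1 <;>
    rcases max_choice (c + r) (c' + r') with h2 | h2 <;>
    rw [hA, hB, h1, h2] <;> linarith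
  refine ⟨(A + B) / 2, (B - A) / 2, by linarith, by linarith, ?_⟩
  rintro a (ha | ha)
  · refine incl h0 ?_ a ha
    rcases abs_cases (c - (A + B) / 2) with h3 | h3 <;> linarith
  · refine incl h0' ?_ a ha
    rcases abs_cases (c' - (A + B) / 2) with h3 | h3 <;> linarith

theorem AxisCovers.abs_le {c r : ℝ} {a : ℝ × ℝ} (h : AxisCovers c r a) (hr : 0 ≤ r) :
    |a.1 - c| ≤ r :=
  abs_le_of_sq_le_sq (le_trans (by nlinarith [sq_nonneg a.2]) h) hr

/-- The dynamic program is not worse than any cover. -/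
theorem IsCoverTable.le_sum {n : ℕ} {X Z : ℕ → ℝ} {prev : ℕ → ℕ} {F c r : ℕ → ℝ}
    (h : IsCoverTable n X Z prev F c r) (hX : ∀ i j, i < j → j < n → X i ≤ X j) :
    ∀ (j : ℕ), j ≤ n → ∀ S : Multiset (ℝ × ℝ), (∀ D ∈ S, 0 ≤ D.2) →
      (∀ k < j, ∃ D ∈ S, AxisCovers D.1 D.2 (X k, Z k)) → F j ≤ (S.map Prod.snd).sum := by
  -- The induction is on the number of disks, because merging two of them leaves `j` unchanged.
  suffices H : ∀ (m j : ℕ), j ≤ n → ∀ S : Multiset (ℝ × ℝ), S.card = m → (∀ D ∈ S, 0 ≤ D.2) →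
      (∀ k < j, ∃ D ∈ S, AxisCovers D.1 D.2 (X k, Z k)) → F j ≤ (S.map Prod.snd).sum from
    fun j hj S => H _ j hj S rfl
  intro m
  induction m with
  | zero =>
    intro j hj S hS _ hcov
    obtain rfl : S = 0 := Multiset.card_eq_zero.1 hS
    obtain rfl : j = 0 := by
      by_contra hj0
      obtain ⟨D, hD, -⟩ := hcov 0 (by omega)
      simp at hD
    simp [h.zero]
  | succ m ih =>
    intro j hj S hS hS0 hcov
    obtain _ | j := j
    · rw [h.zero]
      exact Multiset.sum_nonneg (by simpa using fun x y hxy => hS0 _ hxy)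
    obtain ⟨⟨u, s⟩, hD, hjD⟩ := hcov j (by omega)
    obtain ⟨S, rfl⟩ := Multiset.exists_cons_of_mem hD
    have hs : 0 ≤ s := hS0 _ hD
    have hcard : S.card = m := by simpa using hS
    simp only [Multiset.map_cons, Multiset.sum_cons]
    have hjx := abs_le.1 (hjD.abs_le hs)
    classical
    -- The first point with abscissa in the disk.
    have hex : ∃ i, i ≤ j ∧ u - s ≤ X i := ⟨j, le_rfl, by simp only at hjx; linarith⟩
    obtain ⟨hij, hi⟩ := Nat.find_spec hex
    set i := Nat.find hex with hi_def
    have hmem : ∀ k, i ≤ k → k ≤ j → |X k - u| ≤ s := by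
      intro k hik hkj
      have h1 : X i ≤ X k := by
        rcases eq_or_lt_of_le hik with h | h
        · rw [h]
        · exact hX _ _ h (by omega)
      have h2 : X k ≤ X j := by
        rcases eq_or_lt_of_le hkj with h | h
        · rw [h]
        · exact hX _ _ h (by omega)
      simp only at hjx
      exact abs_le.2 ⟨by linarith, by linarith⟩
    -- Either the disk serves the whole block `i, ..., j` and no earlier point, so that it can be
    -- split off; or it misses some point `k` of the block. In the latter case another disk covers
    -- `k`, and both contain `X k` on the axis, so they can be merged.
    by_cases hall : ∀ k, i ≤ k → k ≤ j → AxisCovers u s (X k, Z k)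
    · have h1 := (h.row j (by omega)).le i hij (by omega) u s hs hall
      have h2 := ih i (by omega) S hcard (fun D hD => hS0 D (Multiset.mem_cons_of_mem hD)) <| by
        intro k hk
        obtain ⟨D, hD, hkD⟩ := hcov k (by omega)
        rcases Multiset.mem_cons.1 hD with rfl | hD
        · have := abs_le.1 (hkD.abs_le hs)
          simp only at this
          exact absurd ⟨by omega, by linarith⟩ (Nat.find_min hex hk)
        · exact ⟨D, hD, hkD⟩
      linarith
    · push Not at hall
      obtain ⟨k, hik, hkj, hk⟩ := hall
      obtain ⟨⟨u', s'⟩, hD', hkD⟩ := hcov k (by omega)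
      rcases Multiset.mem_cons.1 hD' with heq | hD'
      · simp only [Prod.mk.injEq] at heq
        rw [heq.1, heq.2] at hkD
        exact absurd hkD hk
      have hs' : 0 ≤ s' := hS0 _ (Multiset.mem_cons_of_mem hD')
      obtain ⟨S, rfl⟩ := Multiset.exists_cons_of_mem hD'
      obtain ⟨u'', s'', h0, hle, hcov''⟩ :=
        exists_merged_disk hs hs' (hmem k hik hkj) (hkD.abs_le hs')
      have h2 := ih (j + 1) hj ((u'', s'') ::ₘ S) (by simpa using hcard) ?_ ?_
      · simp only [Multiset.map_cons, Multiset.sum_cons] at h2 ⊢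
        linarith
      · intro D hD
        rcases Multiset.mem_cons.1 hD with rfl | hD
        · exact h0
        · exact hS0 D (Multiset.mem_cons_of_mem (Multiset.mem_cons_of_mem hD))
      · intro k hk
        obtain ⟨D, hD, hkD⟩ := hcov k hk
        rcases Multiset.mem_cons.1 hD with rfl | hD
        · exact ⟨_, Multiset.mem_cons_self _ _, hcov'' _ (.inl hkD)⟩
        rcases Multiset.mem_cons.1 hD with rfl | hD
        · exact ⟨_, Multiset.mem_cons_self _ _, hcov'' _ (.inr hkD)⟩
        · exact ⟨D, Multiset.mem_cons_of_mem hD, hkD⟩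

/-! ### The program for a fixed line: sorting, dynamic program, output -/

namespace RealRAM

abbrev nv (x : ℕ) : NatExp := .var x
abbrev rv (x : ℕ) : RealExp := .var x
abbrev ra (a : ℕ) (i : NatExp) : RealExp := .arr a i
abbrev na (a : ℕ) (i : NatExp) : NatExp := .arr a i

/-- Compute the coordinates of the clients in the coordinate system whose first axis is the line
through `p + t n` with direction `d`, where `n` is `d` rotated by a right angle. -/
def coordProg : Program :=
  forLoop 2 (nv 0)
    (.setReal 15 (ra 0 (nv 2) - rv 1) ⨟
     .setReal 16 (ra 1 (nv 2) - rv 2) ⨟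
     .storeReal 5 (nv 2) (rv 15 * rv 8 + rv 16 * rv 9) ⨟
     .storeReal 6 (nv 2) (rv 16 * rv 8 - rv 15 * rv 9 - rv 10))

theorem coordProg_spec {n : ℕ} {s : Store} (hn : s.natVar 0 = n) :
    Ends n coordProg s fun s' => ∀ i < n,
      s'.realArr 5 i = (s.realArr 0 i - s.realVar 1) * s.realVar 8 +
        (s.realArr 1 i - s.realVar 2) * s.realVar 9 ∧
      s'.realArr 6 i = (s.realArr 1 i - s.realVar 2) * s.realVar 8 -
        (s.realArr 0 i - s.realVar 1) * s.realVar 9 - s.realVar 10 := by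
  unfold coordProg
  refine Ends.mono (Ends.forLoop (N := n) (fun k s' => (s'.natVar 0 = n ∧ s'.realArr 0 = s.realArr 0 ∧
    s'.realArr 1 = s.realArr 1 ∧ s'.realVar 1 = s.realVar 1 ∧ s'.realVar 2 = s.realVar 2 ∧
    s'.realVar 8 = s.realVar 8 ∧ s'.realVar 9 = s.realVar 9 ∧ s'.realVar 10 = s.realVar 10) ∧
    ∀ i < k, s'.realArr 5 i = (s.realArr 0 i - s.realVar 1) * s.realVar 8 +
        (s.realArr 1 i - s.realVar 2) * s.realVar 9 ∧
      s'.realArr 6 i = (s.realArr 1 i - s.realVar 2) * s.realVar 8 -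
        (s.realArr 0 i - s.realVar 1) * s.realVar 9 - s.realVar 10)
    le_rfl (by exact fun k s v h => h) (by exact fun k s h => h.1.1) ⟨by simp [hn], by simp⟩ rfl ?_)
    (fun s' h => h.2)
  rintro k s' hk hi ⟨⟨h0, h1, h2, h3, h4, h5, h6, h7⟩, h⟩
  refine Ends.of_wp ?_
  simp only [Program.wp, NatExp.eval, RealExp.eval, RealExp.eval_sub, hi]
  refine ⟨by simp [*], fun i hik => ?_⟩
  rcases eq_or_lt_of_le (Nat.le_of_lt_succ hik) with rfl | hik
  · simp [*]
  · simpa [hik.ne] using h i hik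

/-- Sort the clients by their first coordinates. -/
def sortProg : Program :=
  forLoop 2 (nv 0) (forLoop 3 (nv 0)
    (.cond (.conj (.neg (.natLe (nv 3) (nv 2))) (.neg (.realLe (ra 5 (nv 2)) (ra 5 (nv 3)))))
      (.setReal 15 (ra 5 (nv 2)) ⨟
       .setReal 16 (ra 6 (nv 2)) ⨟
       .storeReal 5 (nv 2) (ra 5 (nv 3)) ⨟
       .storeReal 6 (nv 2) (ra 6 (nv 3)) ⨟
       .storeReal 5 (nv 3) (rv 15) ⨟
       .storeReal 6 (nv 3) (rv 16))
      .nop))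

/-- The points whose coordinates are held by the real arrays `5` and `6`. -/
def Store.points (n : ℕ) (s : Store) : Set (ℝ × ℝ) :=
  {a | ∃ k < n, a = (s.realArr 5 k, s.realArr 6 k)}

theorem points_swap {n i j : ℕ} {X Z X' Z' : ℕ → ℝ} (hi : i < n) (hj : j < n)
    (hX : ∀ k, X' k = X (Equiv.swap i j k)) (hZ : ∀ k, Z' k = Z (Equiv.swap i j k)) :
    {a : ℝ × ℝ | ∃ k < n, a = (X' k, Z' k)} = {a | ∃ k < n, a = (X k, Z k)} := by
  have hlt : ∀ k < n, Equiv.swap i j k < n := by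
    intro k hk
    rw [Equiv.swap_apply_def]
    split_ifs <;> assumption
  ext a
  constructor
  · rintro ⟨k, hk, rfl⟩
    exact ⟨_, hlt k hk, by rw [hX, hZ]⟩
  · rintro ⟨k, hk, rfl⟩
    exact ⟨_, hlt k hk, by rw [hX, hZ, Equiv.swap_apply_self]⟩

/-- Exchange sort, of quadratic time: after round `i` the entry `i` is at most all later ones. Both
coordinates are exchanged together, so the set of points is preserved. -/
theorem sortProg_spec {n : ℕ} {s : Store} (hn : s.natVar 0 = n) :
    Ends n sortProg s fun s' => s'.points n = s.points n ∧
      ∀ i j, i < j → j < n → s'.realArr 5 i ≤ s'.realArr 5 j := by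
  unfold sortProg
  refine Ends.mono (Ends.forLoop (N := n) (fun i s' => s'.natVar 0 = n ∧ s'.points n = s.points n ∧
    ∀ a b, a < i → a < b → b < n → s'.realArr 5 a ≤ s'.realArr 5 b)
    le_rfl (by exact fun k s v h => h) (by exact fun k s h => h.1) ⟨hn, rfl, by simp⟩ rfl ?_)
    (fun s' h => ⟨h.2.1, fun i j hij hj => h.2.2 i j (hij.trans hj) hij hj⟩)
  rintro i s₁ hi hi₁ ⟨h1, h2, h3⟩
  refine Ends.mono (Ends.forLoop (N := n) (fun j s' => (s'.natVar 0 = n ∧ s'.natVar 2 = i) ∧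
    s'.points n = s.points n ∧
    (∀ a b, a < i → a < b → b < n → s'.realArr 5 a ≤ s'.realArr 5 b) ∧
    ∀ b, i < b → b < j → s'.realArr 5 i ≤ s'.realArr 5 b)
    le_rfl (by exact fun k s v h => h) (by exact fun k s h => h.1.1) ⟨⟨h1, hi₁⟩, h2, h3, by omega⟩ rfl ?_)
    (fun s' h => ⟨h.1.1, h.2.1, fun a b ha hab hb => ?_⟩)
  · rintro j s₂ hj hj₂ ⟨⟨h4, h5⟩, h6, h7, h8⟩
    refine Ends.of_wp ?_
    simp only [Program.wp, NatExp.eval, RealExp.eval, Test.eval, h5, hj₂, not_le]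
    refine ⟨fun ⟨hij, hlt⟩ => ?_, fun h => ?_⟩
    · simp only [Function.update_self, ne_eq, not_false_eq_true,
        Function.update_of_ne, Nat.reduceEqDiff]
      have hX : ∀ k, Function.update (Function.update (s₂.realArr 5) i (s₂.realArr 5 j)) j
          (s₂.realArr 5 i) k = s₂.realArr 5 (Equiv.swap i j k) := by
        intro k
        rw [Equiv.swap_apply_def]
        simp only [Function.update_apply]
        grind
      have hZ : ∀ k, Function.update (Function.update (s₂.realArr 6) i (s₂.realArr 6 j)) j
          (s₂.realArr 6 i) k = s₂.realArr 6 (Equiv.swap i j k) := by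
        intro k
        rw [Equiv.swap_apply_def]
        simp only [Function.update_apply]
        grind
      refine ⟨⟨h4, trivial⟩, ?_, ?_, ?_⟩
      · rw [← h6]
        refine points_swap hi hj ?_ ?_
        · simpa using hX
        · simpa using hZ
      · intro a b ha hab hb
        have hb' : a < Equiv.swap i j b ∧ Equiv.swap i j b < n := by
          rw [Equiv.swap_apply_def]
          split_ifs <;> omega
        -- Exchanges act only on positions from `i` on, so the sorted prefix stays in place and
        -- still bounds everything behind it.
        have ha' : Equiv.swap i j a = a := Equiv.swap_apply_of_ne_of_ne (by omega) (by omega)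
        have := h7 a _ ha hb'.1 hb'.2
        rw [← hX, ← congrArg (s₂.realArr 5) ha', ← hX] at this
        simpa using this
      · intro b hib hbj
        simp only [Function.update_apply]
        rcases eq_or_lt_of_le (Nat.le_of_lt_succ hbj) with rfl | hbj
        · simp [hib.ne, hlt.le]
        · simpa [hib.ne, hib.ne', hbj.ne, hij.ne] using hlt.le.trans (h8 b hib hbj)
    · refine ⟨⟨h4, trivial⟩, h6, h7, fun b hib hbj => ?_⟩
      rcases eq_or_lt_of_le (Nat.le_of_lt_succ hbj) with rfl | hbj
      · by_contra hb
        exact h ⟨hib, not_le.1 hb⟩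
      · exact h8 b hib hbj
  · rcases eq_or_lt_of_le (Nat.le_of_lt_succ ha) with rfl | ha
    · exact h.2.2.2 b hab hb
    · exact h.2.2.1 a b ha hab hb

/-- Compute the smallest disk centered on the axis that contains the points with the indices that
are held by the natural number registers `5` and `3`. -/
def pairProg : Program :=
  .setReal 11 ((ra 5 (nv 3) * ra 5 (nv 3) + ra 6 (nv 3) * ra 6 (nv 3) -
    (ra 5 (nv 5) * ra 5 (nv 5) + ra 6 (nv 5) * ra 6 (nv 5))) /
      (.cast (.lit 2) * (ra 5 (nv 3) - ra 5 (nv 5)))) ⨟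
  .cond (.realLe (ra 5 (nv 3)) (rv 11)) (.setReal 11 (ra 5 (nv 3))) .nop ⨟
  .cond (.realLe (rv 11) (ra 5 (nv 5))) (.setReal 11 (ra 5 (nv 5))) .nop ⨟
  .setReal 15 ((ra 5 (nv 5) - rv 11) * (ra 5 (nv 5) - rv 11) + ra 6 (nv 5) * ra 6 (nv 5)) ⨟
  .setReal 16 ((ra 5 (nv 3) - rv 11) * (ra 5 (nv 3) - rv 11) + ra 6 (nv 3) * ra 6 (nv 3)) ⨟
  .cond (.realLe (rv 15) (rv 16)) (.setReal 15 (rv 16)) .nop ⨟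
  .setReal 12 (.sqrt (rv 15))

theorem isMinDisk_pair_sqrt {a b : ℝ × ℝ} (hab : a.1 ≤ b.1) {c : ℝ}
    (hc : c = max a.1 (min b.1
      ((b.1 * b.1 + b.2 * b.2 - (a.1 * a.1 + a.2 * a.2)) / (2 * (b.1 - a.1))))) {v : ℝ}
    (hv : v = max ((a.1 - c) * (a.1 - c) + a.2 * a.2) ((b.1 - c) * (b.1 - c) + b.2 * b.2)) :
    IsMinDisk {a, b} c (√v) := by
  simp only [← sq] at hv
  have h1 : (a.1 - c) ^ 2 + a.2 ^ 2 ≤ v := hv ▸ le_max_left _ _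
  have h2 : (b.1 - c) ^ 2 + b.2 ^ 2 ≤ v := hv ▸ le_max_right _ _
  have h0 : 0 ≤ v := le_trans (by positivity) h1
  refine isMinDisk_pair hab hc (Real.sqrt_nonneg _) ?_ ?_ ?_
  · rwa [AxisCovers, Real.sq_sqrt h0]
  · rwa [AxisCovers, Real.sq_sqrt h0]
  · rw [Real.sq_sqrt h0, hv]
    rcases max_choice ((a.1 - c) ^ 2 + a.2 ^ 2) ((b.1 - c) ^ 2 + b.2 ^ 2) with h | h <;> simp [h]

theorem pairProg_spec {B : ℕ} {s : Store}
    (h : s.realArr 5 (s.natVar 5) ≤ s.realArr 5 (s.natVar 3)) :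
    Ends B pairProg s fun s' =>
      IsMinDisk {(s.realArr 5 (s.natVar 5), s.realArr 6 (s.natVar 5)),
        (s.realArr 5 (s.natVar 3), s.realArr 6 (s.natVar 3))} (s'.realVar 11) (s'.realVar 12) := by
  refine Ends.of_wp ?_
  set a : ℝ × ℝ := (s.realArr 5 (s.natVar 5), s.realArr 6 (s.natVar 5)) with ha
  set b : ℝ × ℝ := (s.realArr 5 (s.natVar 3), s.realArr 6 (s.natVar 3)) with hb
  have e1 : s.realArr 5 (s.natVar 5) = a.1 := rfl
  have e2 : s.realArr 6 (s.natVar 5) = a.2 := rfl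
  have e3 : s.realArr 5 (s.natVar 3) = b.1 := rfl
  have e4 : s.realArr 6 (s.natVar 3) = b.2 := rfl
  rw [e1, e3] at h
  simp only [pairProg, Program.wp, NatExp.eval, RealExp.eval, Test.eval, RealExp.eval_sub,
    RealExp.eval_div, Function.update_self, ne_eq,
    not_false_eq_true, Function.update_of_ne, Nat.reduceEqDiff,
    e1, e2, e3, e4, Nat.cast_ofNat]
  clear_value a b
  refine ⟨fun h1 => ⟨fun h2 => ⟨fun h3 => ?_, fun h3 => ?_⟩, fun h2 => ⟨fun h3 => ?_, fun h3 => ?_⟩⟩,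
    fun h1 => ⟨fun h2 => ⟨fun h3 => ?_, fun h3 => ?_⟩, fun h2 => ⟨fun h3 => ?_, fun h3 => ?_⟩⟩⟩ <;>
  refine isMinDisk_pair_sqrt h ?_ ?_ <;> grind

/-- Compute the smallest disk centered on the axis that contains the points with indices between
those that are held by the natural number registers `5` and `3`. -/
def diskProg : Program :=
  pairProg ⨟
  .cond (.realLe (ra 8 (nv 5)) (rv 12)) .nop
    (.setReal 11 (ra 7 (nv 5)) ⨟ .setReal 12 (ra 8 (nv 5))) ⨟
  .cond (.realLe (rv 14) (rv 12)) .nop (.setReal 11 (rv 13) ⨟ .setReal 12 (rv 14))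

/-- The strict inequalities in the last two alternatives matter for one-point blocks: there the two
stored radii are initialized to `0`, so that the disk of the end points must be the one chosen. -/
theorem diskProg_spec {B i j : ℕ} {s : Store} (hi : s.natVar 5 = i) (hj : s.natVar 3 = j)
    (h : s.realArr 5 i ≤ s.realArr 5 j) :
    Ends B diskProg s fun s' => ∃ c r,
      IsMinDisk {(s.realArr 5 i, s.realArr 6 i), (s.realArr 5 j, s.realArr 6 j)} c r ∧
      r ≤ s'.realVar 12 ∧ s.realArr 8 i ≤ s'.realVar 12 ∧ s.realVar 14 ≤ s'.realVar 12 ∧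
      (s'.realVar 11 = c ∧ s'.realVar 12 = r ∨
        s'.realVar 11 = s.realArr 7 i ∧ s'.realVar 12 = s.realArr 8 i ∧ r < s.realArr 8 i ∨
        s'.realVar 11 = s.realVar 13 ∧ s'.realVar 12 = s.realVar 14 ∧ r < s.realVar 14) := by
  subst hi hj
  refine Ends.seq ((pairProg_spec h).same.mono ?_)
  rintro s₁ ⟨hd, hs⟩
  refine Ends.of_wp ?_
  simp only [Program.wp, NatExp.eval, RealExp.eval, Test.eval, Function.update_self, ne_eq,
    not_false_eq_true, Function.update_of_ne, Nat.reduceEqDiff, hs.nat 5 rfl, hs.realArr 7 rfl,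
    hs.realArr 8 rfl, hs.real 13 rfl, hs.real 14 rfl]
  refine ⟨fun h1 => ⟨fun h2 => ?_, fun h2 => ?_⟩, fun h1 => ⟨fun h2 => ?_, fun h2 => ?_⟩⟩ <;>
  exact ⟨_, _, hd, by grind⟩

/-- Extend the table of the dynamic program by the client with the index in the natural number
register `3`. -/
def rowProg : Program :=
  .storeReal 8 (nv 3) (.cast (.lit 0)) ⨟
  .setReal 14 (.cast (.lit 0)) ⨟
  forLoop 4 (nv 3 + .lit 1)
    (.setNat 5 (nv 3 - nv 4) ⨟
     diskProg ⨟
     .setReal 13 (rv 11) ⨟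
     .setReal 14 (rv 12) ⨟
     .storeReal 7 (nv 5) (rv 11) ⨟
     .storeReal 8 (nv 5) (rv 12) ⨟
     .cond (.conj (.natLe (.lit 1) (nv 4))
         (.realLe (ra 9 (nv 3 + .lit 1)) (ra 9 (nv 5) + rv 12))) .nop
       (.storeReal 9 (nv 3 + .lit 1) (ra 9 (nv 5) + rv 12) ⨟
        .storeReal 10 (nv 3 + .lit 1) (rv 11) ⨟
        .storeReal 11 (nv 3 + .lit 1) (rv 12) ⨟
        .storeNat 0 (nv 3 + .lit 1) (nv 5)))

/-- The memory holds the points `(X, Z)` and the table of the dynamic program for the first `j` of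
them. -/
structure HoldsTable (n : ℕ) (X Z : ℕ → ℝ) (j : ℕ) (s : Store) : Prop where
  hn : s.natVar 0 = n
  hX : s.realArr 5 = X
  hZ : s.realArr 6 = Z
  table : IsCoverTable j X Z (s.natArr 0) (s.realArr 9) (s.realArr 10) (s.realArr 11)

/-- The loop invariant of `rowProg`. -/
structure RowInv (n : ℕ) (X Z : ℕ → ℝ) (j k : ℕ) (s : Store) : Prop extends
    HoldsTable n X Z j s where
  hj : s.natVar 3 = j
  row : 1 ≤ k → IsCoverRow X Z j k (s.natArr 0) (s.realArr 9) (s.realArr 10) (s.realArr 11)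
  done : ∀ i ≤ j, j < i + k →
    IsMinDisk (clientsIcc X Z i j) (s.realArr 7 i) (s.realArr 8 i)
  todo : ∀ i < j, i + k ≤ j →
    IsMinDisk (clientsIcc X Z i (j - 1)) (s.realArr 7 i) (s.realArr 8 i)
  zero_row : k = 0 → s.realArr 8 j = 0
  zero_cur : k = 0 → s.realVar 14 = 0
  cur : 1 ≤ k → IsMinDisk (clientsIcc X Z (j + 1 - k) j) (s.realVar 13) (s.realVar 14)

/-- The block start `i = j - k` runs downwards. When it is reached, arrays `7` and `8` still hold at
`i` the disk of `i, ..., j - 1` from the previous row, while registers `13` and `14` hold that of `i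
+ 1, ..., j`. These are the two sub-blocks needed for `i, ..., j`, so each entry takes constant time
and linear storage suffices. -/
theorem rowProg_spec {n j : ℕ} {X Z : ℕ → ℝ} {s : Store}
    (hX : ∀ i j, i < j → j < n → X i ≤ X j) (hjn : j < n) (hs : HoldsTable n X Z j s)
    (hj : s.natVar 3 = j)
    (hrow : ∀ i < j, IsMinDisk (clientsIcc X Z i (j - 1)) (s.realArr 7 i) (s.realArr 8 i)) :
    Ends n rowProg s fun s' => HoldsTable n X Z (j + 1) s' ∧
      ∀ i < j + 1, IsMinDisk (clientsIcc X Z i j) (s'.realArr 7 i) (s'.realArr 8 i) := by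
  refine Ends.seq (Ends.of_wp (Ends.seq (Ends.of_wp ?_)))
  refine Ends.mono (Ends.forLoop (N := j + 1) (RowInv n X Z j) hjn
    (by exact fun k s v h => ⟨⟨h.hn, h.hX, h.hZ, h.table⟩, h.hj, h.row, h.done, h.todo, h.zero_row, h.zero_cur,
      h.cur⟩) (by intro k s h; simp [h.hj]) ?_ rfl ?_)
    (fun s' h => ⟨⟨h.hn, h.hX, h.hZ, h.table.succ (h.row (by omega))⟩,
      fun i hi => h.done i (by omega) (by omega)⟩)
  · refine ⟨⟨hs.hn, ?_, ?_, ?_⟩, ?_, ?_, ?_, ?_, ?_, ?_, ?_⟩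
    · simpa using hs.hX
    · simpa using hs.hZ
    · simpa using hs.table
    · simpa using hj
    · simp
    · intro i; omega
    · intro i hi _
      simpa [hj, hi.ne] using hrow i hi
    · simp [hj]
    · simp
    · simp
  rintro k s₁ hk hk₁ h
  obtain ⟨i, rfl⟩ : ∃ i, j = i + k := ⟨j - k, by omega⟩
  refine Ends.seq (Ends.of_wp (Ends.seq ((diskProg_spec (i := i) (j := i + k) ?_ ?_ ?_).same.mono
    ?_)))
  · simp [h.hj, hk₁]
  · simpa using h.hj
  · simp only [h.hX]
    rcases Nat.eq_zero_or_pos k with rfl | hk0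
    · exact le_rfl
    · exact hX _ _ (by omega) hjn
  rintro s₂ ⟨⟨c, r, hd, hr, hr1, hr2, hcr⟩, hs₂⟩
  have e0 : s₂.natVar 0 = n := (hs₂.nat 0 rfl).trans h.hn
  have e3 : s₂.natVar 3 = i + k := (hs₂.nat 3 rfl).trans (by simpa using h.hj)
  have e4 : s₂.natVar 4 = k := (hs₂.nat 4 rfl).trans (by simpa using hk₁)
  have e5 : s₂.natVar 5 = i := (hs₂.nat 5 rfl).trans (by simp [h.hj, hk₁])
  have eX : s₂.realArr 5 = X := (hs₂.realArr 5 rfl).trans h.hX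
  have eZ : s₂.realArr 6 = Z := (hs₂.realArr 6 rfl).trans h.hZ
  have a0 : s₂.natArr 0 = s₁.natArr 0 := hs₂.natArr 0 rfl
  have a7 : s₂.realArr 7 = s₁.realArr 7 := hs₂.realArr 7 rfl
  have a8 : s₂.realArr 8 = s₁.realArr 8 := hs₂.realArr 8 rfl
  have a9 : s₂.realArr 9 = s₁.realArr 9 := hs₂.realArr 9 rfl
  have a10 : s₂.realArr 10 = s₁.realArr 10 := hs₂.realArr 10 rfl
  have a11 : s₂.realArr 11 = s₁.realArr 11 := hs₂.realArr 11 rfl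
  simp only [h.hX, h.hZ] at hd hr1 hr2 hcr
  have hmin : IsMinDisk (clientsIcc X Z i (i + k)) (s₂.realVar 11) (s₂.realVar 12) := by
    rcases Nat.eq_zero_or_pos k with rfl | hk0
    · have h1 := h.zero_row rfl
      have h2 := h.zero_cur rfl
      simp only [add_zero] at *
      have h3 := hd.nonneg
      rw [clientsIcc_self]
      rw [Set.pair_eq_singleton] at hd
      rcases hcr with h' | h' | h'
      · rw [h'.1, h'.2]
        exact hd
      · linarith
      · linarith
    · obtain ⟨k, rfl⟩ : ∃ l, k = l + 1 := ⟨k - 1, by omega⟩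
      have h1 := h.todo i (by omega) le_rfl
      have h2 := h.cur hk0
      rw [show i + (k + 1) + 1 - (k + 1) = i + 1 by omega] at h2
      exact IsMinDisk.clientsIcc_succ (j := i + k) (Nat.le_add_right i k) h1 h2 hd hr1 hr2 hr (by tauto)
  have htable := h.table
  have hrow := h.row
  have hdone := h.done
  have htodo := h.todo
  rw [← a0, ← a9, ← a10, ← a11] at htable hrow
  rw [← a7, ← a8] at hdone htodo
  clear h hs₂ hk₁ hs hj hcr hr hr1 hr2 hd a0 a7 a8 a9 a10 a11
  have hdone' : ∀ l ≤ i + k, i + k < l + (k + 1) → IsMinDisk (clientsIcc X Z l (i + k))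
      (Function.update (s₂.realArr 7) i (s₂.realVar 11) l)
      (Function.update (s₂.realArr 8) i (s₂.realVar 12) l) := by
    intro l hl hlk
    by_cases hli : l = i
    · subst hli
      simpa using hmin
    · simpa [hli] using hdone l hl (by omega)
  have htodo' : ∀ l < i + k, l + (k + 1) ≤ i + k → IsMinDisk (clientsIcc X Z l (i + k - 1))
      (Function.update (s₂.realArr 7) i (s₂.realVar 11) l)
      (Function.update (s₂.realArr 8) i (s₂.realVar 12) l) := by
    intro l hl hlk
    simpa [show l ≠ i by omega] using htodo l hl (by omega)
  refine Ends.of_wp ?_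
  simp only [Program.wp, NatExp.eval, RealExp.eval, Test.eval,
    ne_eq, not_false_eq_true, Function.update_of_ne, Nat.reduceEqDiff,
    e3, e4, e5]
  refine ⟨fun ⟨h1, h2⟩ => ?_, fun h1 => ?_⟩
  · refine ⟨⟨e0, ?_, ?_, ?_⟩, e3, fun _ => ?_, ?_, ?_, by simp, by simp, fun _ => ?_⟩
    · simpa using eX
    · simpa using eZ
    · simpa using htable
    · simpa using (hrow h1).step rfl hmin h2
    · simpa using hdone'
    · simpa using htodo'
    · simpa [show i + k + 1 - (k + 1) = i by omega] using hmin
  · refine ⟨⟨e0, ?_, ?_, ?_⟩, e3, fun _ => ?_, ?_, ?_, by simp, by simp, fun _ => ?_⟩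
    · simpa using eX
    · simpa using eZ
    · simpa using htable.update i _ _ _
    · have := IsCoverRow.step_update (X := X) (Z := Z) (i := i) (k := k) rfl hmin hrow ?_
      · simpa using this
      · rcases Nat.eq_zero_or_pos k with hk0 | hk0
        · exact .inl hk0
        · exact .inr (le_of_not_ge fun h2 => h1 ⟨hk0, h2⟩)
    · simpa using hdone'
    · simpa using htodo'
    · simpa [show i + k + 1 - (k + 1) = i by omega] using hmin

/-- Compute the table of the dynamic program. -/
def tableProg : Program :=
  .storeReal 9 (.lit 0) (.cast (.lit 0)) ⨟ forLoop 3 (nv 0) rowProg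

theorem tableProg_spec {n : ℕ} {s : Store} (hn : s.natVar 0 = n)
    (hX : ∀ i j, i < j → j < n → s.realArr 5 i ≤ s.realArr 5 j) :
    Ends n tableProg s fun s' => IsCoverTable n (s.realArr 5) (s.realArr 6) (s'.natArr 0)
      (s'.realArr 9) (s'.realArr 10) (s'.realArr 11) := by
  refine Ends.seq (Ends.of_wp ?_)
  refine Ends.mono (Ends.forLoop (N := n) (fun j s' =>
    HoldsTable n (s.realArr 5) (s.realArr 6) j s' ∧ ∀ i < j,
      IsMinDisk (clientsIcc (s.realArr 5) (s.realArr 6) i (j - 1)) (s'.realArr 7 i)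
        (s'.realArr 8 i))
    le_rfl (by exact fun k s v h => ⟨⟨h.1.hn, h.1.hX, h.1.hZ, h.1.table⟩, h.2⟩)
    (by exact fun k s h => h.1.hn) ?_ rfl ?_) fun s' h => h.1.table
  · exact ⟨⟨hn, by simp, by simp, ⟨by simp, by simp⟩⟩, by simp⟩
  · rintro j s₁ hj hj₁ ⟨h1, h2⟩
    exact rowProg_spec hX hj h1 hj₁ h2

/-- The input registers of the memory describe the clients `Y`. -/
structure HoldsClients {n : ℕ} (Y : Fin n → Plane) (s : Store) : Prop where
  hn : s.natVar 0 = n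
  fst : ∀ i : Fin n, s.realArr 0 i = Y i 0
  snd : ∀ i : Fin n, s.realArr 1 i = Y i 1

/-- `m` disks, with the coordinates `X` and `Z` of the centers and the radii `R`, are a collinear
disk cover of `Y` of cost `v`. -/
structure IsCoverOfCost {n : ℕ} (Y : Fin n → Plane) (m : ℕ) (X Z R : ℕ → ℝ) (v : ℝ) : Prop where
  collinear : ∃ (x z dx dz : ℝ) (τ : ℕ → ℝ), ∀ j < m, X j = x + τ j * dx ∧ Z j = z + τ j * dz
  nonneg : ∀ j < m, 0 ≤ R j
  covers : ∀ i, ∃ j < m, (X j - Y i 0) ^ 2 + (Z j - Y i 1) ^ 2 ≤ R j ^ 2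
  cost : ∑ j ∈ Finset.range m, R j = v

/-- The memory holds a collinear disk cover of `Y` as its output, and its cost in the real register
`6`. -/
def HoldsCover {n : ℕ} (Y : Fin n → Plane) (s : Store) : Prop :=
  IsCoverOfCost Y (s.natVar 1) (s.realArr 2) (s.realArr 3) (s.realArr 4) (s.realVar 6)

theorem HoldsCover.isCollinearCover {n : ℕ} {Y : Fin n → Plane} {s : Store}
    (h : HoldsCover Y s) : IsCollinearCover (Set.range Y) (output s) where
  radius_nonneg := fun j => h.nonneg j j.2
  collinear := by
    obtain ⟨x, z, dx, dz, τ, hτ⟩ := h.collinear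
    rw [collinear_iff_exists_forall_eq_smul_vadd]
    refine ⟨!₂[x, z], !₂[dx, dz], ?_⟩
    rintro _ ⟨j, rfl⟩
    refine ⟨τ j, ?_⟩
    have := hτ j j.2
    ext i
    fin_cases i
    · simp [output, this.1, add_comm]
    · simp [output, this.2, add_comm]
  covers := by
    rintro _ ⟨i, rfl⟩
    obtain ⟨j, hj, hij⟩ := h.covers i
    refine ⟨⟨j, hj⟩, ?_⟩
    rw [EuclideanSpace.dist_eq]
    refine Real.sqrt_le_iff.2 ⟨h.nonneg j hj, ?_⟩
    simpa [output, Real.dist_eq, sq_abs] using hij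

theorem HoldsCover.diskCost {n : ℕ} {Y : Fin n → Plane} {s : Store}
    (h : HoldsCover Y s) : diskCost (output s) = s.realVar 6 := by
  rw [← h.cost, Finset.sum_range]
  rfl

/-- Write the disks of the cover that is described by the table to the output. -/
def writeProg : Program :=
  .setReal 6 (ra 9 (nv 0)) ⨟
  .setNat 1 (.lit 0) ⨟
  .setNat 3 (nv 0) ⨟
  .loop (.natLe (.lit 1) (nv 3))
    (.storeReal 2 (nv 1) (rv 1 - rv 10 * rv 9 + ra 10 (nv 3) * rv 8) ⨟
     .storeReal 3 (nv 1) (rv 2 + rv 10 * rv 8 + ra 10 (nv 3) * rv 9) ⨟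
     .storeReal 4 (nv 1) (ra 11 (nv 3)) ⨟
     .setNat 1 (nv 1 + .lit 1) ⨟
     .setNat 3 (na 0 (nv 3)))

/-- Following `prev` from `n` down to `0` visits the last blocks of optimal prefixes. The index
drops at every step, which bounds the iterations by `n`, and the recursion for `F` telescopes to the
sum of the radii written. -/
theorem writeProg_spec {n : ℕ} {X Z : ℕ → ℝ} {s : Store} (hn : s.natVar 0 = n)
    (h : IsCoverTable n X Z (s.natArr 0) (s.realArr 9) (s.realArr 10) (s.realArr 11)) :
    Ends n writeProg s fun s' => s'.realVar 6 = s.realArr 9 n ∧ ∃ τ : ℕ → ℝ,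
      (∀ q < s'.natVar 1,
        s'.realArr 2 q = s.realVar 1 - s.realVar 10 * s.realVar 9 + τ q * s.realVar 8 ∧
        s'.realArr 3 q = s.realVar 2 + s.realVar 10 * s.realVar 8 + τ q * s.realVar 9 ∧
        0 ≤ s'.realArr 4 q) ∧
      (∀ k < n, ∃ q < s'.natVar 1, AxisCovers (τ q) (s'.realArr 4 q) (X k, Z k)) ∧
      ∑ q ∈ Finset.range (s'.natVar 1), s'.realArr 4 q = s.realArr 9 n := by
  let I : ℕ → Store → Prop := fun m s' =>
    (s'.natVar 1 = m ∧ m + s'.natVar 3 ≤ n) ∧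
    (s'.natArr 0 = s.natArr 0 ∧ s'.realArr 9 = s.realArr 9 ∧ s'.realArr 10 = s.realArr 10 ∧
      s'.realArr 11 = s.realArr 11) ∧
    (s'.realVar 1 = s.realVar 1 ∧ s'.realVar 2 = s.realVar 2 ∧ s'.realVar 8 = s.realVar 8 ∧
      s'.realVar 9 = s.realVar 9 ∧ s'.realVar 10 = s.realVar 10 ∧
      s'.realVar 6 = s.realArr 9 n) ∧
    ∃ τ : ℕ → ℝ,
      (∀ q < m,
        s'.realArr 2 q = s.realVar 1 - s.realVar 10 * s.realVar 9 + τ q * s.realVar 8 ∧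
        s'.realArr 3 q = s.realVar 2 + s.realVar 10 * s.realVar 8 + τ q * s.realVar 9 ∧
        0 ≤ s'.realArr 4 q) ∧
      (∀ k < n, s'.natVar 3 ≤ k → ∃ q < m, AxisCovers (τ q) (s'.realArr 4 q) (X k, Z k)) ∧
      s.realArr 9 (s'.natVar 3) + ∑ q ∈ Finset.range m, s'.realArr 4 q = s.realArr 9 n
  refine Ends.seq (Ends.of_wp (Ends.seq (Ends.of_wp (Ends.seq (Ends.of_wp
    (Ends.mono (Ends.loop I ?_ ?_) ?_))))))
  · refine ⟨by simp [hn], by simp, by simp [hn], 0, by simp, ?_, by simp [hn]⟩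
    intro k hk hk'
    simp [hn] at hk'
    omega
  · rintro m s' ⟨⟨h1, h2⟩, ⟨a0, a9, a10, a11⟩, ⟨b1, b2, b8, b9, b10, b6⟩, τ, h3, h4, h5⟩ hb
    obtain ⟨j, hj⟩ : ∃ j, s'.natVar 3 = j + 1 := ⟨s'.natVar 3 - 1, by simp at hb; omega⟩
    have hrow := h.row j (by omega)
    refine ⟨by omega, Ends.of_wp ?_⟩
    simp only [Program.wp, NatExp.eval, RealExp.eval, RealExp.eval_sub]
    refine ⟨⟨by simp [h1], ?_⟩, by simp [*], by simp [*], Function.update τ m (s.realArr 10 (j + 1)),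
      ?_, ?_, ?_⟩
    · have := hrow.prev_le
      simp [a0, hj]
      omega
    · intro q hq
      rcases eq_or_lt_of_le (Nat.le_of_lt_succ hq) with rfl | hq
      · have := hrow.nonneg
        simp [*]
      · simpa [h1, hq.ne] using h3 q hq
    · intro k hk hjk
      simp [a0, hj] at hjk
      rcases Nat.lt_or_ge k (j + 1) with hkj | hkj
      · refine ⟨m, by omega, ?_⟩
        simpa [h1, a11, hj] using hrow.covers k hjk (by omega)
      · obtain ⟨q, hq, hq'⟩ := h4 k hk (by omega)
        refine ⟨q, by omega, ?_⟩
        simpa [h1, hq.ne] using hq'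
    · rw [Finset.sum_range_succ, ← h5, hj, hrow.eq]
      have : ∀ v, ∑ q ∈ Finset.range m, Function.update (s'.realArr 4) m v q =
          ∑ q ∈ Finset.range m, s'.realArr 4 q := fun v => Finset.sum_congr rfl fun q hq => by
        simp [(Finset.mem_range.1 hq).ne]
      simp [h1, a0, a11, hj, this]
      ring
  · rintro s' ⟨m, ⟨⟨h1, h2⟩, -, hb, τ, h3, h4, h5⟩, hb'⟩
    have h0 : s'.natVar 3 = 0 := by simpa using hb'
    rw [h0, h.zero, zero_add] at h5
    subst h1
    exact ⟨hb.2.2.2.2.2, τ, h3, fun k hk => h4 k hk (by omega), h5⟩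

/-- Cover the clients by disks with centers on the line through `p + t n` with direction `d`, and
output the best such cover if it is better than the present output. -/
def lineProg : Program :=
  coordProg ⨟ sortProg ⨟ tableProg ⨟ .cond (.realLe (rv 6) (ra 9 (nv 0))) .nop writeProg

/-- The coordinates of a point with respect to the line through `p + t n` with direction `d`. -/
def lineCoords (s : Store) (y : Plane) : ℝ × ℝ :=
  ((y 0 - s.realVar 1) * s.realVar 8 + (y 1 - s.realVar 2) * s.realVar 9,
    (y 1 - s.realVar 2) * s.realVar 8 - (y 0 - s.realVar 1) * s.realVar 9 - s.realVar 10)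

/-- Since the direction is a unit vector, passing to line coordinates preserves distances. The
output is overwritten only by a cheaper cover, so the cost in register `6` never increases during
the search. -/
theorem lineProg_spec {n : ℕ} {Y : Fin n → Plane} {s : Store} (hY : HoldsClients Y s)
    (hs : HoldsCover Y s) (hd : s.realVar 8 ^ 2 + s.realVar 9 ^ 2 = 1) :
    Ends n lineProg s fun s' => HoldsCover Y s' ∧ s'.realVar 6 ≤ s.realVar 6 ∧
      ∀ S : Multiset (ℝ × ℝ), (∀ D ∈ S, 0 ≤ D.2) →
        (∀ i, ∃ D ∈ S, AxisCovers D.1 D.2 (lineCoords s (Y i))) →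
        s'.realVar 6 ≤ (S.map Prod.snd).sum := by
  refine Ends.seq ((coordProg_spec hY.hn).same.mono ?_)
  rintro s₁ ⟨hc, hs₁⟩
  refine Ends.seq ((sortProg_spec ((hs₁.nat 0 rfl).trans hY.hn)).same.mono ?_)
  rintro s₂ ⟨⟨hp, hX⟩, hs₂⟩
  refine Ends.seq ((tableProg_spec ((hs₂.nat 0 rfl).trans ((hs₁.nat 0 rfl).trans hY.hn))
    hX).same.mono ?_)
  rintro s₃ ⟨ht, hs₃⟩
  have nat : ∀ x, x < 2 → s₃.natVar x = s.natVar x := fun x hx => by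
    interval_cases x <;> exact (hs₃.nat _ rfl).trans ((hs₂.nat _ rfl).trans (hs₁.nat _ rfl))
  have real : ∀ x, x < 11 → s₃.realVar x = s.realVar x := fun x hx => by
    interval_cases x <;> exact (hs₃.real _ rfl).trans ((hs₂.real _ rfl).trans (hs₁.real _ rfl))
  have arr : ∀ x, x < 5 → s₃.realArr x = s.realArr x := fun x hx => by
    interval_cases x <;>
    exact (hs₃.realArr _ rfl).trans ((hs₂.realArr _ rfl).trans (hs₁.realArr _ rfl))
  have hpoint : ∀ i, ∃ k < n, lineCoords s (Y i) = (s₂.realArr 5 k, s₂.realArr 6 k) := by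
    intro i
    have hmem : lineCoords s (Y i) ∈ s₁.points n := by
      refine ⟨i, i.2, ?_⟩
      rw [(hc i i.2).1, (hc i i.2).2, hY.fst, hY.snd]
      rfl
    rw [← hp] at hmem
    exact hmem
  have hclient : ∀ k < n, ∃ i, lineCoords s (Y i) = (s₂.realArr 5 k, s₂.realArr 6 k) := by
    intro k hk
    have hmem : (s₂.realArr 5 k, s₂.realArr 6 k) ∈ s₂.points n := ⟨k, hk, rfl⟩
    rw [hp] at hmem
    obtain ⟨i, hi, heq⟩ := hmem
    refine ⟨⟨i, hi⟩, ?_⟩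
    rw [heq, (hc i hi).1, (hc i hi).2, hY.fst ⟨i, hi⟩, hY.snd ⟨i, hi⟩]
    rfl
  have hopt : ∀ S : Multiset (ℝ × ℝ), (∀ D ∈ S, 0 ≤ D.2) →
      (∀ i, ∃ D ∈ S, AxisCovers D.1 D.2 (lineCoords s (Y i))) →
      s₃.realArr 9 n ≤ (S.map Prod.snd).sum := by
    intro S hS hcov
    refine ht.le_sum hX n le_rfl S hS fun k hk => ?_
    obtain ⟨i, hi⟩ := hclient k hk
    rw [← hi]
    exact hcov i
  have hn : s₃.natVar 0 = n := (nat 0 (by norm_num)).trans hY.hn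
  refine Ends.cond (fun hle => Ends.of_wp ⟨?_, ?_, ?_⟩) (fun hlt => (writeProg_spec hn ht).mono ?_)
  · rw [HoldsCover, nat 1 (by norm_num), arr 2 (by norm_num), arr 3 (by norm_num),
      arr 4 (by norm_num), real 6 (by norm_num)]
    exact hs
  · exact (real 6 (by norm_num)).le
  · intro S hS hcov
    refine le_trans ?_ (hopt S hS hcov)
    simpa [hn] using hle
  · rintro s₄ ⟨h6, τ, hτ, hcov, hsum⟩
    rw [real 1 (by norm_num), real 2 (by norm_num), real 8 (by norm_num), real 9 (by norm_num),
      real 10 (by norm_num)] at hτ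
    refine ⟨⟨⟨_, _, _, _, τ, fun q hq => ⟨(hτ q hq).1, (hτ q hq).2.1⟩⟩, fun q hq => (hτ q hq).2.2,
      fun i => ?_, hsum.trans h6.symm⟩, ?_, fun S hS hS' => h6 ▸ hopt S hS hS'⟩
    · obtain ⟨k, hk, hik⟩ := hpoint i
      obtain ⟨q, hq, hkq⟩ := hcov k hk
      refine ⟨q, hq, le_trans (le_of_eq ?_) hkq⟩
      rw [← hik, (hτ q hq).1, (hτ q hq).2.1]
      simp only [lineCoords]
      linear_combination (s.realVar 10 ^ 2 + τ q ^ 2 - (Y i 0 - s.realVar 1) ^ 2 -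
        (Y i 1 - s.realVar 2) ^ 2) * hd
    · rw [h6]
      simp [hn, real 6] at hlt
      exact hlt.le

end RealRAM

/-! ### Rounding the line of a collinear disk cover -/

open ComplexConjugate

/-- A point of the plane as a complex number. -/
def Plane.toComplex (y : Plane) : ℂ := ⟨y 0, y 1⟩

theorem Plane.dist_eq_norm (y z : Plane) : dist y z = ‖y.toComplex - z.toComplex‖ := by
  rw [EuclideanSpace.dist_eq, Complex.norm_eq_sqrt_sq_add_sq]
  simp [toComplex, Real.dist_eq, sq_abs]

/-- The unit vector `u`, rotated by the angle whose half has the tangent `s`. -/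
noncomputable def rotateHalf (u : ℂ) (s : ℝ) : ℂ :=
  u * ⟨(1 - s * s) / (1 + s * s), (s + s) / (1 + s * s)⟩

theorem norm_rotateHalf {u : ℂ} (hu : ‖u‖ = 1) (s : ℝ) : ‖rotateHalf u s‖ = 1 := by
  have h : 1 + s * s ≠ 0 := by nlinarith [mul_self_nonneg s]
  rw [rotateHalf, norm_mul, hu, one_mul, Complex.norm_eq_sqrt_sq_add_sq, Real.sqrt_eq_one]
  field_simp
  ring

/-- The squared chord is exactly `4 (s - s')^2 / ((1 + s^2) (1 + s'^2))`. -/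
theorem norm_rotateHalf_sub_le {u : ℂ} (hu : ‖u‖ = 1) (s s' : ℝ) :
    ‖rotateHalf u s - rotateHalf u s'‖ ≤ 2 * |s - s'| := by
  have h : 0 < 1 + s * s := by nlinarith [mul_self_nonneg s]
  have h' : 0 < 1 + s' * s' := by nlinarith [mul_self_nonneg s']
  rw [rotateHalf, rotateHalf, ← mul_sub, norm_mul, hu, one_mul, Complex.norm_eq_sqrt_sq_add_sq]
  refine Real.sqrt_le_iff.2 ⟨by positivity, ?_⟩
  rw [mul_pow, sq_abs]
  have key : ((1 - s * s) / (1 + s * s) - (1 - s' * s') / (1 + s' * s')) ^ 2 +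
      ((s + s) / (1 + s * s) - (s' + s') / (1 + s' * s')) ^ 2 =
      2 ^ 2 * (s - s') ^ 2 / ((1 + s * s) * (1 + s' * s')) := by
    field_simp
    ring
  simp only [Complex.sub_re, Complex.sub_im]
  rw [key]
  refine div_le_self (by positivity) ?_
  nlinarith [mul_self_nonneg s, mul_self_nonneg s', mul_self_nonneg (s * s')]

theorem mul_conj_of_norm_eq_one {d : ℂ} (hd : ‖d‖ = 1) : d * conj d = 1 := by
  rw [Complex.mul_conj, Complex.normSq_eq_norm_sq, hd]
  simp

/-- Multiplication by `conj d` is an isometry that turns the direction `d` into the real axis. -/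
theorem sq_norm_sub_line {d : ℂ} (hd : ‖d‖ = 1) (w : ℂ) (x t : ℝ) :
    ‖w - ⟨x, t⟩ * d‖ ^ 2 = ((w * conj d).re - x) ^ 2 + ((w * conj d).im - t) ^ 2 := by
  have h : ‖w - ⟨x, t⟩ * d‖ = ‖w * conj d - ⟨x, t⟩‖ := by
    rw [← mul_one ‖w - ⟨x, t⟩ * d‖, ← hd, ← RCLike.norm_conj d, ← norm_mul, sub_mul, mul_assoc,
      mul_conj_of_norm_eq_one hd, mul_one]
  rw [h, Complex.sq_norm, Complex.normSq_apply, Complex.sub_re, Complex.sub_im]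
  ring

/-- Every unit vector at an angle of at most a right one to `u` is of the form `rotateHalf u s`. -/
theorem exists_rotateHalf_eq {u d : ℂ} (hu : ‖u‖ = 1) (hd : ‖d‖ = 1) (h : 0 ≤ (d * conj u).re) :
    ∃ s, rotateHalf u s = d ∧ |s| ≤ |(d * conj u).im| := by
  obtain ⟨e, he⟩ : ∃ e, e = d * conj u := ⟨_, rfl⟩
  rw [← he] at h ⊢
  have hue : u * e = d := by
    rw [he, mul_left_comm, mul_conj_of_norm_eq_one hu, mul_one]
  have hnorm : e.re ^ 2 + e.im ^ 2 = 1 := by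
    have : ‖e‖ ^ 2 = 1 := by rw [he, norm_mul, RCLike.norm_conj, hu, hd]; norm_num
    rw [Complex.sq_norm, Complex.normSq_apply] at this
    linarith
  have h1 : 1 + e.re ≠ 0 := by linarith
  have h2 : 1 + e.im / (1 + e.re) * (e.im / (1 + e.re)) = 2 / (1 + e.re) := by
    field_simp
    linarith
  -- The tangent of half the argument of `e`. As `e.re ≥ 0`, the denominator is at least `1`, whence
  -- the bound on `|s|`.
  refine ⟨e.im / (1 + e.re), ?_, ?_⟩
  · rw [rotateHalf, ← hue]
    congr 1
    refine Complex.ext ?_ ?_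
    · simp only
      rw [h2]
      field_simp
      linear_combination (-1 : ℝ) * hnorm
    · simp only
      rw [h2]
      field_simp
      ring
  · rw [abs_div, abs_of_nonneg (a := 1 + e.re) (by linarith)]
    exact div_le_self (abs_nonneg _) (by linarith)

/-- The centers of a collinear cover in coordinates along their line. -/
theorem exists_line_coords {k : ℕ} {c : Fin k → Plane} (hc : Collinear ℝ (Set.range c)) (p u : ℂ)
    (hu : ‖u‖ = 1) : ∃ (d : ℂ) (t : ℝ) (x : Fin k → ℝ), ‖d‖ = 1 ∧ 0 ≤ (d * conj u).re ∧
      ∀ j, (c j).toComplex - p = ⟨x j, t⟩ * d := by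
  obtain ⟨q, v, hq⟩ := (collinear_iff_exists_forall_eq_smul_vadd _).1 hc
  choose r hr using fun j => hq (c j) ⟨j, rfl⟩
  have hc' : ∀ j, (c j).toComplex = r j * v.toComplex + q.toComplex := by
    intro j
    rw [hr j]
    apply Complex.ext <;> simp [Plane.toComplex]
  obtain ⟨d, m, hd, hdu, hm⟩ : ∃ (d : ℂ) (m : ℝ), ‖d‖ = 1 ∧ 0 ≤ (d * conj u).re ∧
      v.toComplex = m * d := by
    set w := v.toComplex
    by_cases hw : w = 0
    -- All centers coincide, and any direction may be chosen.
    · exact ⟨u, 0, hu, by simp [mul_conj_of_norm_eq_one hu], by simp [hw]⟩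
    have hw' : ((‖w‖ : ℝ) : ℂ) ≠ 0 := by simpa using hw
    rcases le_total 0 (w / ‖w‖ * conj u).re with h | h
    · exact ⟨w / ‖w‖, ‖w‖, by simp [hw], h, by field_simp⟩
    · refine ⟨-(w / ‖w‖), -‖w‖, by simp [hw], ?_, ?_⟩
      · rw [neg_mul, Complex.neg_re]
        linarith
      · push_cast
        field_simp
  refine ⟨d, ((q.toComplex - p) * conj d).im, fun j => r j * m + ((q.toComplex - p) * conj d).re,
    hd, hdu, fun j => ?_⟩
  have h1 : (⟨r j * m + ((q.toComplex - p) * conj d).re, ((q.toComplex - p) * conj d).im⟩ : ℂ) =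
      r j * m + (q.toComplex - p) * conj d := by
    apply Complex.ext <;> simp
  have h2 := mul_conj_of_norm_eq_one hd
  rw [h1, hc', hm]
  linear_combination (-(q.toComplex - p)) * h2

/-- A client `p`, a farthest client from `p` at distance `L`, and the direction `u` to it. -/
structure IsFrame {n : ℕ} (Y : Fin n → Plane) (p u : ℂ) (L : ℝ) : Prop where
  norm_dir : ‖u‖ = 1
  base : ∃ i, (Y i).toComplex = p
  far : ∃ i, (Y i).toComplex = p + L * u
  le : ∀ i, ‖(Y i).toComplex - p‖ ≤ L

theorem IsFrame.nonneg {n : ℕ} {Y : Fin n → Plane} {p u : ℂ} {L : ℝ} (h : IsFrame Y p u L) :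
    0 ≤ L := by
  obtain ⟨i, -⟩ := h.base
  exact (norm_nonneg _).trans (h.le i)

/-- The line through the centers of a collinear cover, in coordinates. -/
theorem IsFrame.exists_line {n k : ℕ} {Y : Fin n → Plane} {p u : ℂ} {L : ℝ} (h : IsFrame Y p u L)
    {D : Fin k → Disk} (hD : IsCollinearCover (Set.range Y) D) :
    ∃ (d : ℂ) (t : ℝ) (x : Fin k → ℝ), ‖d‖ = 1 ∧ 0 ≤ (d * conj u).re ∧
      (∀ i, ∃ j, ‖(Y i).toComplex - p - ⟨x j, t⟩ * d‖ ≤ (D j).radius) ∧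
      (∀ i, |(((Y i).toComplex - p) * conj d).im - t| ≤ diskCost D) ∧
      |t| ≤ diskCost D ∧ L * |(d * conj u).im| ≤ 2 * diskCost D := by
  obtain ⟨d, t, x, hd, hdu, hx⟩ := exists_line_coords hD.collinear p u h.norm_dir
  have hcov : ∀ i, ∃ j, ‖(Y i).toComplex - p - ⟨x j, t⟩ * d‖ ≤ (D j).radius := by
    intro i
    obtain ⟨j, hj⟩ := hD.covers (Y i) ⟨i, rfl⟩
    refine ⟨j, ?_⟩
    rw [← hx j]
    rw [dist_comm, Plane.dist_eq_norm] at hj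
    convert hj using 2
    ring
  have hwidth : ∀ i, |(((Y i).toComplex - p) * conj d).im - t| ≤ diskCost D := by
    intro i
    obtain ⟨j, hj⟩ := hcov i
    have h1 : (D j).radius ≤ diskCost D :=
      Finset.single_le_sum (f := fun j => (D j).radius) (fun j _ => hD.radius_nonneg j)
        (Finset.mem_univ j)
    refine le_trans (abs_le_of_sq_le_sq ?_ (norm_nonneg _)) (hj.trans h1)
    rw [sq_norm_sub_line hd]
    nlinarith [sq_nonneg ((((Y i).toComplex - p) * conj d).re - x j)]
  obtain ⟨i, hi⟩ := h.base
  have ht : |t| ≤ diskCost D := by simpa [hi] using hwidth i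
  refine ⟨d, t, x, hd, hdu, hcov, hwidth, ht, ?_⟩
  obtain ⟨i, hi⟩ := h.far
  have h1 := hwidth i
  -- The base client and the far client both lie within the cost of the line; the difference of
  -- their offsets is `L` times the sine of the angle between `u` and `d`.
  have h2 : (L * u * conj d).im = -(L * (d * conj u).im) := by
    simp
    ring
  rw [hi, add_sub_cancel_left, h2] at h1
  rw [← abs_of_nonneg h.nonneg, ← abs_mul]
  rw [abs_le] at *
  constructor <;> linarith

/-- The distances of the clients from the axis of the frame are at most four times the cost of any
collinear cover. -/
theorem IsFrame.abs_im_le {n k : ℕ} {Y : Fin n → Plane} {p u : ℂ} {L : ℝ} (h : IsFrame Y p u L)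
    {D : Fin k → Disk} (hD : IsCollinearCover (Set.range Y) D) (i : Fin n) :
    |(((Y i).toComplex - p) * conj u).im| ≤ 4 * diskCost D := by
  obtain ⟨d, t, x, hd, -, -, hw, ht, hu⟩ := h.exists_line hD
  have hV : 0 ≤ diskCost D := (abs_nonneg _).trans ht
  have hwi := h.le i
  have hwi' := hw i
  set w := (Y i).toComplex - p
  rcases eq_or_lt_of_le h.nonneg with hL | hL
  · rw [← hL] at hwi
    rw [norm_le_zero_iff.1 hwi]
    simpa using hV
  have h1 : |(w * conj d).re| ≤ L := (Complex.abs_re_le_norm _).trans <| by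
    rwa [norm_mul, RCLike.norm_conj, hd, mul_one]
  have h2 : |(w * conj d).im| ≤ 2 * diskCost D := by
    rw [abs_le] at *
    constructor <;> linarith
  have h3 : |(d * conj u).re| ≤ 1 := (Complex.abs_re_le_norm _).trans <| by
    rw [norm_mul, RCLike.norm_conj, hd, h.norm_dir, mul_one]
  have h4 : w * conj u = w * conj d * (d * conj u) := by
    linear_combination (-w * conj u) * mul_conj_of_norm_eq_one hd
  rw [h4, Complex.mul_im]
  generalize (w * conj d).re = A at *
  generalize (w * conj d).im = B at *
  generalize (d * conj u).re = A' at *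
  generalize (d * conj u).im = B' at *
  have h5 : |A * B' + B * A'| ≤ |A| * |B'| + |B| * |A'| := by
    rw [← abs_mul, ← abs_mul]
    exact abs_add_le _ _
  have h6 : |A| * |B'| ≤ L * |B'| := by gcongr
  have h7 : |B| * |A'| ≤ 2 * diskCost D * 1 := by gcongr
  linarith

/-- Rounding down to a multiple of `ε g / (10 n)`, starting from `-2 g`. -/
theorem exists_round {n : ℕ} (hn : 1 ≤ n) {ε g x : ℝ} (hε : 0 < ε) (hg : 0 ≤ g)
    (hx : |x| ≤ 2 * g) : ∃ a : ℕ, a * ε ≤ 40 * n ∧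
      |x - (-(2 * g) + a * (ε * g / (10 * n)))| ≤ ε * g / (10 * n) := by
  have hn' : (0 : ℝ) < n := by exact_mod_cast hn
  rw [abs_le] at hx
  rcases eq_or_lt_of_le hg with rfl | hg
  · refine ⟨0, by simp, ?_⟩
    have : x = 0 := by linarith
    simp [this]
  set τ := ε * g / (10 * n) with hτ
  have hτ0 : 0 < τ := by positivity
  have h0 : 0 ≤ (x + 2 * g) / τ := div_nonneg (by linarith) hτ0.le
  have h1 := Nat.floor_le h0
  have h2 := (Nat.lt_floor_add_one ((x + 2 * g) / τ)).le
  set a := ⌊(x + 2 * g) / τ⌋₊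
  rw [le_div_iff₀ hτ0] at h1
  rw [div_le_iff₀ hτ0] at h2
  refine ⟨a, ?_, ?_⟩
  -- The interval `[-2 g, 2 g]` has length `4 g`, which is `40 n / ε` grid steps.
  · have h3 : a * τ ≤ 4 * g := by linarith
    rw [hτ, ← mul_div_assoc, div_le_iff₀ (by positivity)] at h3
    refine le_of_mul_le_mul_right ?_ hg
    linarith
  · rw [abs_le]
    constructor <;> linarith

/-- A grid line has a cover that is nearly as good as a given collinear cover. -/
theorem IsFrame.exists_grid_line {n k : ℕ} {Y : Fin n → Plane} {p u : ℂ} {L : ℝ}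
    (h : IsFrame Y p u L) {D : Fin k → Disk} (hD : IsCollinearCover (Set.range Y) D)
    (hDL : diskCost D ≤ L) {ε g : ℝ} (hε : 0 < ε) (hg : diskCost D ≤ g)
    (hg' : g ≤ 2 * diskCost D) :
    ∃ a b : ℕ, a * ε ≤ 40 * n ∧ b * ε ≤ 40 * n ∧
      ∃ S : Multiset (ℝ × ℝ), (∀ E ∈ S, 0 ≤ E.2) ∧
        (∀ i, ∃ E ∈ S, ‖(Y i).toComplex - p -
          ⟨E.1, -(2 * g) + a * (ε * g / (10 * n))⟩ *
            rotateHalf u ((-(2 * g) + b * (ε * g / (10 * n))) / L)‖ ≤ E.2) ∧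
        (S.map Prod.snd).sum ≤ (1 + ε) * diskCost D := by
  classical
  obtain ⟨i₀, -⟩ := h.base
  have hn : 1 ≤ n := i₀.pos
  have hn' : (0 : ℝ) < n := by exact_mod_cast hn
  obtain ⟨d, t, x, hd, hdu, hcov, -, ht, hLd⟩ := h.exists_line hD
  obtain ⟨s, hs, hsd⟩ := exists_rotateHalf_eq h.norm_dir hd hdu
  have hV : 0 ≤ diskCost D := (abs_nonneg _).trans ht
  have hg0 : 0 ≤ g := hV.trans hg
  have hL := h.nonneg
  have hsL : |L * s| ≤ 2 * g := by
    rw [abs_mul, abs_of_nonneg hL]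
    have : L * |s| ≤ L * |(d * conj u).im| := by gcongr
    linarith
  obtain ⟨a, ha, ha'⟩ := exists_round hn hε hg0 (x := t) (by linarith)
  obtain ⟨b, hb, hb'⟩ := exists_round hn hε hg0 hsL
  set τ := ε * g / (10 * n) with hτ
  have hτ0 : 0 ≤ τ := by positivity
  refine ⟨a, b, ha, hb, ?_⟩
  set t' := -(2 * g) + a * τ
  set s' := (-(2 * g) + b * τ) / L
  have hss : L * |s - s'| ≤ τ := by
    -- For `L = 0` the direction is irrelevant, whatever the division by zero in `s'` returns.
    rcases eq_or_lt_of_le hL with hL0 | hL0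
    · rw [← hL0, zero_mul]
      exact hτ0
    · rw [← abs_of_pos hL0, ← abs_mul, mul_sub, mul_div_cancel₀ _ hL0.ne']
      exact hb'
  set d' := rotateHalf u s'
  have hd' : ‖d'‖ = 1 := norm_rotateHalf h.norm_dir _
  have hdd : ‖d - d'‖ ≤ 2 * |s - s'| := hs ▸ norm_rotateHalf_sub_le h.norm_dir s s'
  -- A rotation moves a center in proportion to its distance from `p`. All clients have abscissas in
  -- `[-L, L]`, so moving the centers into this interval keeps them covered and bounds that
  -- distance.
  let clamp : ℝ → ℝ := fun x => max (-L) (min L x)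
  have habs : ∀ x, |clamp x| ≤ L := fun x =>
    abs_le.2 ⟨le_max_left _ _, max_le (by linarith) (min_le_left _ _)⟩
  have hclamp : ∀ ξ x, |ξ| ≤ L → (ξ - clamp x) ^ 2 ≤ (ξ - x) ^ 2 := by
    intro ξ x hξ
    rw [abs_le] at hξ
    simp only [clamp]
    rcases le_total L x with h1 | h1
    · rw [min_eq_left h1, max_eq_right (by linarith)]
      nlinarith
    · rw [min_eq_right h1]
      rcases le_total (-L) x with h2 | h2
      · rw [max_eq_right h2]
      · rw [max_eq_left h2]
        nlinarith
  choose f hf using hcov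
  -- One chosen disk per client is kept, hence at most `n` disks. Of the enlargement, `4 τ` pays for
  -- the rotation and `τ` for the change of offset.
  refine ⟨(Finset.univ.image f).val.map fun j => (clamp (x j), (D j).radius + 5 * τ), ?_, ?_, ?_⟩
  · intro E hE
    obtain ⟨j, -, rfl⟩ := Multiset.mem_map.1 hE
    have := hD.radius_nonneg j
    positivity
  · intro i
    refine ⟨_, Multiset.mem_map_of_mem _ (Finset.mem_image_of_mem f (Finset.mem_univ i)), ?_⟩
    simp only
    have h1 := hf i
    have hw := h.le i
    set w := (Y i).toComplex - p
    set r := (D (f i)).radius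
    set c := clamp (x (f i))
    have h2 : ‖w - ⟨c, t⟩ * d‖ ≤ r := by
      refine le_trans (le_of_sq_le_sq ?_ (norm_nonneg _)) h1
      rw [sq_norm_sub_line hd, sq_norm_sub_line hd]
      have := hclamp (w * conj d).re (x (f i)) <| (Complex.abs_re_le_norm _).trans <| by
        rwa [norm_mul, RCLike.norm_conj, hd, mul_one]
      linarith
    have h3 : ‖(⟨c, t⟩ : ℂ)‖ ≤ 2 * L := by
      refine (Complex.norm_le_abs_re_add_abs_im _).trans ?_
      have := habs (x (f i))
      simp only
      linarith
    have h4 : ‖(⟨c, t⟩ : ℂ) * (d - d')‖ ≤ 4 * τ := by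
      rw [norm_mul]
      calc _ ≤ 2 * L * (2 * |s - s'|) := by gcongr
        _ = 4 * (L * |s - s'|) := by ring
        _ ≤ _ := by gcongr
    have h5 : ‖((t - t' : ℝ) : ℂ) * Complex.I * d'‖ ≤ τ := by
      rw [norm_mul, norm_mul, hd', Complex.norm_I, Complex.norm_real, mul_one, mul_one]
      exact ha'
    have h6 : w - ⟨c, t'⟩ * d' = (w - ⟨c, t⟩ * d) + ⟨c, t⟩ * (d - d') +
        ((t - t' : ℝ) : ℂ) * Complex.I * d' := by
      have e1 : (⟨c, t'⟩ : ℂ) = c + t' * Complex.I := Complex.mk_eq_add_mul_I _ _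
      have e2 : (⟨c, t⟩ : ℂ) = c + t * Complex.I := Complex.mk_eq_add_mul_I _ _
      rw [e1, e2]
      push_cast
      ring
    rw [h6]
    refine (norm_add₃_le).trans ?_
    linarith
  · rw [Multiset.map_map]
    change ∑ j ∈ Finset.univ.image f, ((D j).radius + 5 * τ) ≤ _
    rw [Finset.sum_add_distrib, Finset.sum_const, nsmul_eq_mul]
    have h1 : ∑ j ∈ Finset.univ.image f, (D j).radius ≤ diskCost D :=
      Finset.sum_le_sum_of_subset_of_nonneg (Finset.subset_univ _)
        fun j _ _ => hD.radius_nonneg j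
    have h2 : ((Finset.univ.image f).card : ℝ) ≤ n := by
      exact_mod_cast Finset.card_image_le.trans (by simp)
    -- By `g ≤ 2 V`, with `V` the cost of `D`, the total enlargement is at most `ε V`.
    have h3 : (n : ℝ) * (5 * τ) = ε * g / 2 := by
      rw [hτ]
      field_simp
      ring
    have h4 : ((Finset.univ.image f).card : ℝ) * (5 * τ) ≤ n * (5 * τ) := by gcongr
    nlinarith

/-! ### The search: frame, projection, grid lines and scales -/

namespace RealRAM

/-- Find a client that is farthest from the first one. -/
def frameProg : Program :=
  .setReal 1 (ra 0 (.lit 0)) ⨟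
  .setReal 2 (ra 1 (.lit 0)) ⨟
  .setReal 3 (.cast (.lit 1)) ⨟
  .setReal 4 (.cast (.lit 0)) ⨟
  .setReal 5 (.cast (.lit 0)) ⨟
  forLoop 2 (nv 0)
    (.setReal 15 (ra 0 (nv 2) - rv 1) ⨟
     .setReal 16 (ra 1 (nv 2) - rv 2) ⨟
     .setReal 11 (.sqrt (rv 15 * rv 15 + rv 16 * rv 16)) ⨟
     .cond (.realLe (rv 11) (rv 5)) .nop
      (.setReal 5 (rv 11) ⨟
       .setReal 3 (rv 15 / rv 11) ⨟
       .setReal 4 (rv 16 / rv 11)))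

/-- The memory holds a frame of the clients `Y`. -/
def HoldsFrame {n : ℕ} (Y : Fin n → Plane) (s : Store) : Prop :=
  IsFrame Y ⟨s.realVar 1, s.realVar 2⟩ ⟨s.realVar 3, s.realVar 4⟩ (s.realVar 5)

/-- The initial direction `1` with `L = 0` is a valid frame of the first client alone. The direction
is replaced only on meeting a strictly larger distance, so no division by zero occurs. -/
theorem frameProg_spec {n : ℕ} (hn : 1 ≤ n) {Y : Fin n → Plane} {s : Store}
    (hY : HoldsClients Y s) : Ends n frameProg s (HoldsFrame Y) := by
  let i₀ : Fin n := ⟨0, hn⟩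
  have e0 : s.realArr 0 0 = Y i₀ 0 := hY.fst i₀
  have e1 : s.realArr 1 0 = Y i₀ 1 := hY.snd i₀
  refine Ends.seq (Ends.of_wp (Ends.seq (Ends.of_wp (Ends.seq (Ends.of_wp (Ends.seq (Ends.of_wp
    (Ends.seq (Ends.of_wp ?_)))))))))
  refine Ends.mono (Ends.forLoop (N := n) (fun k s' => HoldsClients Y s' ∧
    ‖(⟨s'.realVar 3, s'.realVar 4⟩ : ℂ)‖ = 1 ∧ 0 ≤ s'.realVar 5 ∧
    (Y i₀).toComplex = ⟨s'.realVar 1, s'.realVar 2⟩ ∧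
    (∃ i, (Y i).toComplex = ⟨s'.realVar 1, s'.realVar 2⟩ +
      s'.realVar 5 * ⟨s'.realVar 3, s'.realVar 4⟩) ∧
    ∀ i : Fin n, i < k → ‖(Y i).toComplex - ⟨s'.realVar 1, s'.realVar 2⟩‖ ≤ s'.realVar 5)
    le_rfl (by exact fun k s v h => ⟨⟨h.1.hn, h.1.fst, h.1.snd⟩, h.2⟩)
    (by exact fun k s h => h.1.hn) ?_ rfl ?_)
    fun s' h => ⟨h.2.1, ⟨i₀, h.2.2.2.1⟩, h.2.2.2.2.1, fun i => h.2.2.2.2.2 i i.2⟩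
  · refine ⟨⟨hY.hn, hY.fst, hY.snd⟩, ?_, by simp, ?_, ⟨i₀, ?_⟩, by simp⟩
    · simp [Complex.norm_eq_sqrt_sq_add_sq]
    · simp [e0, e1, Plane.toComplex]
    · simp [e0, e1, Plane.toComplex]
  · rintro k s' hk hk' ⟨h1, h2, hL0, h3, h4, h5⟩
    let i : Fin n := ⟨k, hk⟩
    have f0 : s'.realArr 0 k = Y i 0 := h1.fst i
    have f1 : s'.realArr 1 k = Y i 1 := h1.snd i
    have hw : ∀ a b : ℝ, √(a * a + b * b) = ‖(⟨a, b⟩ : ℂ)‖ := fun a b => by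
      rw [Complex.norm_eq_sqrt_sq_add_sq, sq, sq]
    have hYi : (Y i).toComplex - ⟨s'.realVar 1, s'.realVar 2⟩ =
      ⟨Y i 0 - s'.realVar 1, Y i 1 - s'.realVar 2⟩ := rfl
    have hlt : ∀ L, s'.realVar 5 ≤ L →
        ‖(⟨Y i 0 - s'.realVar 1, Y i 1 - s'.realVar 2⟩ : ℂ)‖ ≤ L → ∀ j : Fin n, j < k + 1 →
        ‖(Y j).toComplex - ⟨s'.realVar 1, s'.realVar 2⟩‖ ≤ L := by
      intro L hL hiL j hj
      rcases eq_or_lt_of_le (Nat.le_of_lt_succ hj) with hj | hj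
      · rw [show j = i from Fin.ext hj, hYi]
        exact hiL
      · exact (h5 j hj).trans hL
    refine Ends.of_wp ?_
    simp only [Program.wp, NatExp.eval, RealExp.eval, Test.eval, RealExp.eval_sub,
      RealExp.eval_div, Function.update_self, ne_eq, not_false_eq_true, Function.update_of_ne,
      Nat.reduceEqDiff, hk', f0, f1, hw]
    refine ⟨fun hle => ⟨⟨h1.hn, h1.fst, h1.snd⟩, ?_, ?_, ?_, ?_, ?_⟩,
      fun hgt => ⟨⟨h1.hn, h1.fst, h1.snd⟩, ?_, ?_, ?_, ⟨i, ?_⟩, ?_⟩⟩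
    · simpa using h2
    · simpa using hL0
    · simpa using h3
    · simpa using h4
    · simpa using hlt _ le_rfl hle
    all_goals
      set w : ℂ := ⟨Y i 0 - s'.realVar 1, Y i 1 - s'.realVar 2⟩ with hw
      have hw0 : ‖w‖ ≠ 0 := by linarith
      have hdiv : (⟨(Y i 0 - s'.realVar 1) / ‖w‖, (Y i 1 - s'.realVar 2) / ‖w‖⟩ : ℂ) = w / ‖w‖ := by
        apply Complex.ext <;> simp [hw, Complex.div_ofReal_re, Complex.div_ofReal_im]
    · simp [hdiv, hw0]
    · simp
    · simpa using h3
    · have hw1 : ((‖w‖ : ℝ) : ℂ) ≠ 0 := by exact_mod_cast hw0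
      simp [hdiv]
      rw [mul_div_cancel₀ _ hw1, ← hYi]
      ring
    · simpa using hlt _ (not_le.1 hgt).le le_rfl

/-- Project the clients to the axis of the frame. -/
def projectProg : Program :=
  .setReal 6 (.cast (.lit 0)) ⨟
  .setNat 1 (.lit 0) ⨟
  forLoop 2 (nv 0)
    (.setReal 15 (ra 0 (nv 2) - rv 1) ⨟
     .setReal 16 (ra 1 (nv 2) - rv 2) ⨟
     .setReal 11 (rv 15 * rv 3 + rv 16 * rv 4) ⨟
     .setReal 12 (rv 16 * rv 3 - rv 15 * rv 4) ⨟
     .setReal 12 (.sqrt (rv 12 * rv 12)) ⨟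
     .storeReal 2 (nv 2) (rv 1 + rv 11 * rv 3) ⨟
     .storeReal 3 (nv 2) (rv 2 + rv 11 * rv 4) ⨟
     .storeReal 4 (nv 2) (rv 12) ⨟
     .setReal 6 (rv 6 + rv 12) ⨟
     .setNat 1 (nv 1 + .lit 1)) ⨟
  .setReal 18 (rv 6)

/-- Each client gets the disk around its foot on the axis, whose radius is its distance `|ζ i|` from
the axis. The hypothesis on `V` is supplied by `IsFrame.abs_im_le`. -/
theorem projectProg_spec {n : ℕ} {Y : Fin n → Plane} {s : Store} (hY : HoldsClients Y s)
    (hF : HoldsFrame Y s) :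
    Ends n projectProg s fun s' => HoldsCover Y s' ∧ s'.realVar 18 = s'.realVar 6 ∧
      ∀ V, (∀ i, |(((Y i).toComplex - ⟨s.realVar 1, s.realVar 2⟩) *
        conj (⟨s.realVar 3, s.realVar 4⟩ : ℂ)).im| ≤ 4 * V) → s'.realVar 6 ≤ 4 * n * V := by
  refine Ends.seq (Ends.of_wp (Ends.seq (Ends.of_wp ?_)))
  let ξ : ℕ → ℝ := fun i => (s.realArr 0 i - s.realVar 1) * s.realVar 3 +
    (s.realArr 1 i - s.realVar 2) * s.realVar 4
  let ζ : ℕ → ℝ := fun i => (s.realArr 1 i - s.realVar 2) * s.realVar 3 -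
    (s.realArr 0 i - s.realVar 1) * s.realVar 4
  refine Ends.seq (Ends.mono (Ends.forLoop (N := n) (fun k s' =>
    (s'.natVar 0 = n ∧ s'.natVar 1 = k ∧ s'.realArr 0 = s.realArr 0 ∧
      s'.realArr 1 = s.realArr 1 ∧ s'.realVar 1 = s.realVar 1 ∧ s'.realVar 2 = s.realVar 2 ∧
      s'.realVar 3 = s.realVar 3 ∧ s'.realVar 4 = s.realVar 4) ∧
    (∀ i < k, s'.realArr 2 i = s.realVar 1 + ξ i * s.realVar 3 ∧
      s'.realArr 3 i = s.realVar 2 + ξ i * s.realVar 4 ∧ s'.realArr 4 i = |ζ i|) ∧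
    s'.realVar 6 = ∑ i ∈ Finset.range k, |ζ i|)
    le_rfl (by exact fun k s v h => h)
    (by exact fun k s h => h.1.1) ?_ rfl ?_) fun s' h => Ends.of_wp ?_)
  · simp [hY.hn]
  · rintro k s' hk hk' ⟨⟨h0, h1, h2, h3, h4, h5, h6, h7⟩, h8, h9⟩
    refine Ends.of_wp ?_
    simp only [Program.wp, NatExp.eval, RealExp.eval, RealExp.eval_sub, hk', h1]
    refine ⟨by simp [*], fun i hi => ?_, ?_⟩
    · rcases eq_or_lt_of_le (Nat.le_of_lt_succ hi) with rfl | hi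
      · simp [*, ξ, ζ, Real.sqrt_mul_self_eq_abs]
      · simpa [hi.ne] using h8 i hi
    · rw [Finset.sum_range_succ]
      simp [*, ζ, Real.sqrt_mul_self_eq_abs]
  · obtain ⟨⟨h0, h1, -⟩, h8, h9⟩ := h
    have hu : s.realVar 3 ^ 2 + s.realVar 4 ^ 2 = 1 := by
      have := hF.norm_dir
      rwa [Complex.norm_eq_sqrt_sq_add_sq, Real.sqrt_eq_one] at this
    refine ⟨⟨⟨s.realVar 1, s.realVar 2, s.realVar 3, s.realVar 4, ξ, fun j hj => ?_⟩, fun j hj => ?_, fun i => ⟨i, ?_, ?_⟩, ?_⟩, ?_,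
      fun V hV => ?_⟩
    · simp [h1] at hj
      simpa using ⟨(h8 j hj).1, (h8 j hj).2.1⟩
    · simp [h1] at hj
      simp [(h8 j hj).2.2]
    · simp [h1]
    · dsimp only
      rw [(h8 i i.2).1, (h8 i i.2).2.1, (h8 i i.2).2.2, sq_abs, ← hY.fst i, ← hY.snd i]
      refine le_of_eq ?_
      simp only [ξ, ζ]
      linear_combination (((s.realArr 0 i - s.realVar 1) * s.realVar 3 +
        (s.realArr 1 i - s.realVar 2) * s.realVar 4) ^ 2 - (s.realArr 0 i - s.realVar 1) ^ 2 -
        (s.realArr 1 i - s.realVar 2) ^ 2) * hu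
    · simp [h1, h9]
      exact Finset.sum_congr rfl fun i hi => (h8 i (Finset.mem_range.1 hi)).2.2
    · simp
    · simp [h9]
      calc ∑ i ∈ Finset.range n, |ζ i| ≤ ∑ i ∈ Finset.range n, 4 * V := by
            refine Finset.sum_le_sum fun i hi => ?_
            have hi' := Finset.mem_range.1 hi
            refine le_trans (le_of_eq ?_) (hV ⟨i, hi'⟩)
            have e0 := hY.fst ⟨i, hi'⟩
            have e1 := hY.snd ⟨i, hi'⟩
            simp only at e0 e1
            simp only [ζ, Plane.toComplex, Complex.mul_im, Complex.sub_re, Complex.sub_im,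
              Complex.conj_re, Complex.conj_im, e0, e1]
            congr 1
            ring
        _ = 4 * n * V := by simp; ring

/-- Only the branch taken is charged, unlike in `EndsIn.cond`. This keeps the case of large `ε` free
of the cost of the search. -/
theorem EndsIn.cond_true {T : ℕ} {b : Test} {p q : Program} {s : Store} {Q : Store → Prop}
    (hb : b.eval s) (h : EndsIn T p s Q) : EndsIn (1 + b.cost + T) (.cond b p q) s Q := by
  obtain ⟨s', t, h1, h2, h3⟩ := h
  exact ⟨s', _, .condTrue hb h1, by omega, h3⟩

theorem EndsIn.cond_false {T : ℕ} {b : Test} {p q : Program} {s : Store} {Q : Store → Prop}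
    (hb : ¬ b.eval s) (h : EndsIn T q s Q) : EndsIn (1 + b.cost + T) (.cond b p q) s Q := by
  obtain ⟨s', t, h1, h2, h3⟩ := h
  exact ⟨s', _, .condFalse hb h1, by omega, h3⟩

section rules
variable {T x : ℕ} {q : Program} {s : Store} {Q : Store → Prop}

theorem EndsIn.setNat {e : NatExp}
    (h : Q { s with natVar := Function.update s.natVar x (e.eval s) }) :
    EndsIn (1 + e.cost) (.setNat x e) s Q :=
  ⟨_, _, .setNat x e s, le_rfl, h⟩

theorem EndsIn.setNat_seq {e : NatExp}
    (h : EndsIn T q { s with natVar := Function.update s.natVar x (e.eval s) } Q) :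
    EndsIn (1 + e.cost + T) (.setNat x e ⨟ q) s Q :=
  EndsIn.seq (EndsIn.setNat h)

theorem EndsIn.setReal_seq {e : RealExp}
    (h : EndsIn T q { s with realVar := Function.update s.realVar x (e.eval s) } Q) :
    EndsIn (1 + e.cost + T) (.setReal x e ⨟ q) s Q :=
  EndsIn.seq ⟨_, _, .setReal x e s, le_rfl, h⟩

end rules

/-- The value `v` is at most the cost of any cover by disks that are centered on the line with the
index `(a, b)` in the grid of scale `g`. -/
def LeGridLine {n : ℕ} (Y : Fin n → Plane) (p u : ℂ) (L ε g v : ℝ) (a b : ℕ) : Prop :=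
  ∀ S : Multiset (ℝ × ℝ), (∀ E ∈ S, 0 ≤ E.2) →
    (∀ i, ∃ E ∈ S, ‖(Y i).toComplex - p -
      ⟨E.1, -(2 * g) + a * (ε * g / (10 * n))⟩ *
        rotateHalf u ((-(2 * g) + b * (ε * g / (10 * n))) / L)‖ ≤ E.2) →
    v ≤ (S.map Prod.snd).sum

/-- Compute the direction of a grid line, and cover the clients from this line. -/
def gridLineProg : Program :=
  .setReal 19 ((.cast (.lit 0) - .cast (.lit 2) * rv 7 + .cast (nv 8) * rv 17) / rv 5) ⨟
  .setReal 20 (.cast (.lit 1) + rv 19 * rv 19) ⨟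
  .setReal 21 ((.cast (.lit 1) - rv 19 * rv 19) / rv 20) ⨟
  .setReal 22 ((rv 19 + rv 19) / rv 20) ⨟
  .setReal 8 (rv 3 * rv 21 - rv 4 * rv 22) ⨟
  .setReal 9 (rv 3 * rv 22 + rv 4 * rv 21) ⨟
  lineProg

/-- The memory holds a frame and a cover that is not worse than the initial one, of cost `S₀`. -/
structure HoldsSearch {n : ℕ} (Y : Fin n → Plane) (ε : ℝ) (p u : ℂ) (L S₀ : ℝ) (s : Store) :
    Prop where
  clients : HoldsClients Y s
  cover : HoldsCover Y s
  frame : IsFrame Y p u L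
  eps : s.realVar 0 = ε
  base : (⟨s.realVar 1, s.realVar 2⟩ : ℂ) = p
  dir : (⟨s.realVar 3, s.realVar 4⟩ : ℂ) = u
  dist : s.realVar 5 = L
  initial : s.realVar 18 = S₀
  le : s.realVar 6 ≤ S₀

theorem gridLineProg_spec {n a b : ℕ} {Y : Fin n → Plane} {ε L S₀ g : ℝ} {p u : ℂ} {s : Store}
    (hs : HoldsSearch Y ε p u L S₀ s) (hg : s.realVar 7 = g)
    (hτ : s.realVar 17 = ε * g / (10 * n)) (ht : s.realVar 10 = -(2 * g) + a * (ε * g / (10 * n)))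
    (hb : s.natVar 8 = b) :
    Ends n gridLineProg s fun s' => HoldsSearch Y ε p u L S₀ s' ∧ s'.realVar 6 ≤ s.realVar 6 ∧
      LeGridLine Y p u L ε g (s'.realVar 6) a b := by
  refine Ends.mono (Ends.same (Q := fun s' => HoldsCover Y s' ∧ s'.realVar 6 ≤ s.realVar 6 ∧
      LeGridLine Y p u L ε g (s'.realVar 6) a b) ?_) ?_
  · refine Ends.seq (Ends.of_wp (Ends.seq (Ends.of_wp (Ends.seq (Ends.of_wp (Ends.seq (Ends.of_wp
      (Ends.seq (Ends.of_wp (Ends.seq (Ends.of_wp ?_)))))))))))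
    simp only [Program.wp, NatExp.eval, RealExp.eval, RealExp.eval_sub, RealExp.eval_div,
      Function.update_self, ne_eq, not_false_eq_true,
      Function.update_of_ne, Nat.reduceEqDiff, hg, hτ, hb, hs.dist, Nat.cast_zero, Nat.cast_one,
      Nat.cast_ofNat, zero_sub]
    set σ := (-(2 * g) + b * (ε * g / (10 * n))) / L with hσ
    have hrot : rotateHalf u σ =
        ⟨s.realVar 3 * ((1 - σ * σ) / (1 + σ * σ)) - s.realVar 4 * ((σ + σ) / (1 + σ * σ)),
          s.realVar 3 * ((σ + σ) / (1 + σ * σ)) + s.realVar 4 * ((1 - σ * σ) / (1 + σ * σ))⟩ := by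
      rw [rotateHalf, ← hs.dir]
      apply Complex.ext <;> simp
    generalize s.realVar 3 * ((1 - σ * σ) / (1 + σ * σ)) - s.realVar 4 * ((σ + σ) / (1 + σ * σ))
      = dx at *
    generalize s.realVar 3 * ((σ + σ) / (1 + σ * σ)) + s.realVar 4 * ((1 - σ * σ) / (1 + σ * σ))
      = dy at *
    have hd : ‖(⟨dx, dy⟩ : ℂ)‖ = 1 := hrot ▸ norm_rotateHalf hs.frame.norm_dir σ
    have hd' : dx ^ 2 + dy ^ 2 = 1 := by
      rwa [Complex.norm_eq_sqrt_sq_add_sq, Real.sqrt_eq_one] at hd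
    refine (lineProg_spec (Y := Y) (by exact ⟨hs.clients.hn, hs.clients.fst, hs.clients.snd⟩) ?_ ?_).mono ?_
    · simpa [HoldsCover] using hs.cover
    · simpa using hd'
    · rintro s' ⟨h1, h2, h3⟩
      refine ⟨h1, by simpa using h2, fun S hS hcov => h3 S hS fun i => ?_⟩
      obtain ⟨E, hE, hiE⟩ := hcov i
      refine ⟨E, hE, ?_⟩
      rw [← hσ, hrot, ← hs.base] at hiE
      -- Covering in the complex plane becomes `AxisCovers` in line coordinates after squaring.
      have := pow_le_pow_left₀ (norm_nonneg _) hiE 2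
      rw [sq_norm_sub_line hd] at this
      refine le_trans (le_of_eq ?_) this
      simp [lineCoords, Plane.toComplex, ht]
      ring
  · rintro s' ⟨⟨h1, h2, h3⟩, h4⟩
    refine ⟨⟨⟨?_, ?_, ?_⟩, h1, hs.frame, ?_, ?_, ?_, ?_, ?_, h2.trans hs.le⟩, h2, h3⟩
    · exact (h4.nat 0 rfl).trans hs.clients.hn
    · rw [h4.realArr 0 rfl]
      exact hs.clients.fst
    · rw [h4.realArr 1 rfl]
      exact hs.clients.snd
    · exact (h4.real 0 rfl).trans hs.eps
    · rw [h4.real 1 rfl, h4.real 2 rfl, hs.base]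
    · rw [h4.real 3 rfl, h4.real 4 rfl, hs.dir]
    · exact (h4.real 5 rfl).trans hs.dist
    · exact (h4.real 18 rfl).trans hs.initial

/-- Cover the clients from all grid lines with the same offset. -/
def gridRowProg : Program :=
  .loop (.realLe (.cast (nv 8) * rv 0) (.cast (.lit 40) * .cast (nv 0)))
    (gridLineProg ⨟ .setNat 8 (nv 8 + .lit 1))

/-- Cover the clients from all grid lines of one scale. -/
def gridProg : Program :=
  .loop (.realLe (.cast (nv 7) * rv 0) (.cast (.lit 40) * .cast (nv 0)))
    (.setReal 10 (.cast (.lit 0) - .cast (.lit 2) * rv 7 + .cast (nv 7) * rv 17) ⨟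
     .setNat 8 (.lit 0) ⨟
     gridRowProg ⨟
     .setNat 7 (nv 7 + .lit 1))

/-- Cover the clients from the grid lines of all scales. -/
def searchProg : Program :=
  .setNat 9 (.lit 1) ⨟
  .loop (.realLe (.cast (nv 9)) (.cast (.lit 8) * .cast (nv 0)))
    (.setReal 7 (.cast (nv 9) * rv 18 / (.cast (.lit 4) * .cast (nv 0))) ⨟
     .setReal 17 (rv 0 * rv 7 / (.cast (.lit 10) * .cast (nv 0))) ⨟
     .setNat 7 (.lit 0) ⨟
     gridProg ⨟
     .setNat 9 (nv 9 + nv 9))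

theorem HoldsSearch.setNat {n : ℕ} {Y : Fin n → Plane} {ε L S₀ : ℝ} {p u : ℂ} {s : Store}
    (h : HoldsSearch Y ε p u L S₀ s) {x : ℕ} (hx : 2 ≤ x) (v : ℕ) :
    HoldsSearch Y ε p u L S₀ { s with natVar := Function.update s.natVar x v } where
  clients := ⟨by simpa [show 0 ≠ x by omega] using h.clients.hn, h.clients.fst, h.clients.snd⟩
  cover := by simpa [HoldsCover, show 1 ≠ x by omega] using h.cover
  frame := h.frame
  eps := h.eps
  base := h.base
  dir := h.dir
  dist := h.dist
  initial := h.initial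
  le := h.le

theorem HoldsSearch.setReal {n : ℕ} {Y : Fin n → Plane} {ε L S₀ : ℝ} {p u : ℂ} {s : Store}
    (h : HoldsSearch Y ε p u L S₀ s) {x : ℕ} (hx : 7 ≤ x) (hx' : x ≠ 18) (v : ℝ) :
    HoldsSearch Y ε p u L S₀ { s with realVar := Function.update s.realVar x v } where
  clients := ⟨h.clients.hn, h.clients.fst, h.clients.snd⟩
  cover := by simpa [HoldsCover, show 6 ≠ x by omega] using h.cover
  frame := h.frame
  eps := by simpa [show 0 ≠ x by omega] using h.eps
  base := by simpa [show 1 ≠ x by omega, show 2 ≠ x by omega] using h.base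
  dir := by simpa [show 3 ≠ x by omega, show 4 ≠ x by omega] using h.dir
  dist := by simpa [show 5 ≠ x by omega] using h.dist
  initial := by simpa [hx'.symm] using h.initial
  le := by simpa [show 6 ≠ x by omega] using h.le

theorem LeGridLine.mono {n : ℕ} {Y : Fin n → Plane} {p u : ℂ} {L ε g v v' : ℝ} {a b : ℕ}
    (h : LeGridLine Y p u L ε g v a b) (hv : v' ≤ v) : LeGridLine Y p u L ε g v' a b :=
  fun S h1 h2 => hv.trans (h S h1 h2)

/-- The machine has no floor function: the grid loops test `k * ε ≤ 40 * n`, and the floor only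
enters the count of their iterations. -/
theorem lt_floor_add_one_of_mul_le {k : ℕ} {ε x : ℝ} (hε : 0 < ε) (h : k * ε ≤ x) :
    k < ⌊x / ε⌋₊ + 1 :=
  Nat.lt_succ_of_le (Nat.le_floor ((le_div_iff₀ hε).2 h))

theorem gridRowProg_spec {n a : ℕ} {Y : Fin n → Plane} {ε L S₀ g : ℝ} {p u : ℂ} {s : Store}
    (hε : 0 < ε) (hs : HoldsSearch Y ε p u L S₀ s) (hg : s.realVar 7 = g)
    (hτ : s.realVar 17 = ε * g / (10 * n)) (ht : s.realVar 10 = -(2 * g) + a * (ε * g / (10 * n)))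
    (hb : s.natVar 8 = 0) :
    EndsIn ((⌊40 * n / ε⌋₊ + 1 + 1) * (11 + (gridLineProg.timeBound n + 4))) gridRowProg s fun s' =>
      HoldsSearch Y ε p u L S₀ s' ∧ s'.realVar 6 ≤ s.realVar 6 ∧
      ∀ b : ℕ, b * ε ≤ 40 * n → LeGridLine Y p u L ε g (s'.realVar 6) a b := by
  refine EndsIn.mono (EndsIn.loop (T := gridLineProg.timeBound n + 4) (fun k s' =>
    HoldsSearch Y ε p u L S₀ s' ∧ s'.realVar 6 ≤ s.realVar 6 ∧
    (s'.realVar 7 = g ∧ s'.realVar 17 = s.realVar 17 ∧ s'.realVar 10 = s.realVar 10 ∧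
      s'.natVar 8 = k) ∧
    ∀ b < k, LeGridLine Y p u L ε g (s'.realVar 6) a b) (⌊40 * n / ε⌋₊ + 1) ?_ ?_) ?_ ?_
  · exact ⟨hs, le_rfl, ⟨hg, rfl, rfl, hb⟩, by simp⟩
  · rintro k s₁ ⟨h1, h2, ⟨h3, h4, h5, h6⟩, h7⟩ htest
    simp [h6, h1.eps, h1.clients.hn] at htest
    refine ⟨lt_floor_add_one_of_mul_le hε htest, EndsIn.seq (T' := 4) (EndsIn.mono
      (gridLineProg_spec (a := a) h1 h3 (h4.trans hτ) (h5.trans ht) h6).same le_rfl ?_)⟩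
    rintro s₂ ⟨⟨g1, g2, g3⟩, g4⟩
    refine EndsIn.setNat ⟨g1.setNat (by norm_num) _,
      g2.trans h2, ⟨?_, ?_, ?_, ?_⟩, ?_⟩
    · exact (g4.real 7 rfl).trans h3
    · exact (g4.real 17 rfl).trans h4
    · exact (g4.real 10 rfl).trans h5
    · simpa using (g4.nat 8 rfl).trans h6
    · intro b hb
      rcases eq_or_lt_of_le (Nat.le_of_lt_succ hb) with rfl | hb
      · exact g3
      · exact (h7 b hb).mono g2
  · exact le_rfl
  · rintro s' ⟨k, ⟨h1, h2, ⟨h3, h4, h5, h6⟩, h7⟩, htest⟩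
    simp [h6, h1.eps, h1.clients.hn] at htest
    refine ⟨h1, h2, fun b hb => h7 b ?_⟩
    have : (b : ℝ) * ε < k * ε := hb.trans_lt htest
    exact_mod_cast lt_of_mul_lt_mul_right this hε.le

theorem gridProg_spec {n : ℕ} {Y : Fin n → Plane} {ε L S₀ g : ℝ} {p u : ℂ} {s : Store}
    (hε : 0 < ε) (hs : HoldsSearch Y ε p u L S₀ s) (hg : s.realVar 7 = g)
    (hτ : s.realVar 17 = ε * g / (10 * n)) (ha : s.natVar 7 = 0) :
    EndsIn ((⌊40 * n / ε⌋₊ + 1 + 1) * (11 + (13 + (2 +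
      ((⌊40 * n / ε⌋₊ + 1 + 1) * (11 + (gridLineProg.timeBound n + 4)) + 4))))) gridProg s fun s' =>
      HoldsSearch Y ε p u L S₀ s' ∧ s'.realVar 6 ≤ s.realVar 6 ∧
      ∀ a b : ℕ, a * ε ≤ 40 * n → b * ε ≤ 40 * n →
        LeGridLine Y p u L ε g (s'.realVar 6) a b := by
  refine EndsIn.mono (EndsIn.loop (T := 13 + (2 +
      ((⌊40 * n / ε⌋₊ + 1 + 1) * (11 + (gridLineProg.timeBound n + 4)) + 4))) (fun k s' =>
    HoldsSearch Y ε p u L S₀ s' ∧ s'.realVar 6 ≤ s.realVar 6 ∧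
    (s'.realVar 7 = g ∧ s'.realVar 17 = s.realVar 17 ∧ s'.natVar 7 = k) ∧
    ∀ a b : ℕ, a < k → b * ε ≤ 40 * n → LeGridLine Y p u L ε g (s'.realVar 6) a b)
    (⌊40 * n / ε⌋₊ + 1) ?_ ?_) ?_ ?_
  · exact ⟨hs, le_rfl, ⟨hg, rfl, ha⟩, by simp⟩
  · rintro k s₁ ⟨h1, h2, ⟨h3, h4, h6⟩, h7⟩ htest
    simp [h6, h1.eps, h1.clients.hn] at htest
    refine ⟨lt_floor_add_one_of_mul_le hε htest, EndsIn.setReal_seq (EndsIn.setNat_seq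
      (EndsIn.seq (EndsIn.mono
      (gridRowProg_spec (a := k) (g := g) hε ((h1.setReal (by norm_num) (by norm_num) _).setNat
        (by norm_num) _) ?_ ?_ ?_ ?_).same le_rfl ?_)))⟩
    · simpa using h3
    · simpa using h4.trans hτ
    · simp [h3, h4, h6, hτ]
    · simp
    rintro s₂ ⟨⟨g1, g2, g3⟩, g4⟩
    have g2 : s₂.realVar 6 ≤ s₁.realVar 6 := by simpa using g2
    refine EndsIn.setNat ⟨g1.setNat (by norm_num) _,
      g2.trans h2, ⟨?_, ?_, ?_⟩, ?_⟩
    · exact (g4.real 7 rfl).trans (by simpa using h3)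
    · exact (g4.real 17 rfl).trans (by simpa using h4)
    · simpa using (g4.nat 7 rfl).trans (by simpa using h6)
    · intro a b ha hb
      rcases eq_or_lt_of_le (Nat.le_of_lt_succ ha) with rfl | ha
      · exact g3 b hb
      · exact (h7 a b ha hb).mono g2
  · exact le_rfl
  · rintro s' ⟨k, ⟨h1, h2, ⟨h3, h4, h6⟩, h7⟩, htest⟩
    simp [h6, h1.eps, h1.clients.hn] at htest
    refine ⟨h1, h2, fun a b ha hb => h7 a b ?_ hb⟩
    have : (a : ℝ) * ε < k * ε := ha.trans_lt htest
    exact_mod_cast lt_of_mul_lt_mul_right this hε.le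

/-- Register `9` holds `2^m`, doubled by an addition until it exceeds `8 n`; this gives the
logarithmic number of scales. -/
theorem searchProg_spec {n : ℕ} {Y : Fin n → Plane} {ε L S₀ : ℝ} {p u : ℂ}
    {s : Store} (hε : 0 < ε) (hs : HoldsSearch Y ε p u L S₀ s) :
    EndsIn (2 + (Nat.log 2 (8 * n) + 1 + 1) * (9 + (11 + (10 + (2 +
      ((⌊40 * n / ε⌋₊ + 1 + 1) * (11 + (13 + (2 +
      ((⌊40 * n / ε⌋₊ + 1 + 1) * (11 + (gridLineProg.timeBound n + 4)) + 4)))) + 4))))))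
      searchProg s fun s' =>
      HoldsSearch Y ε p u L S₀ s' ∧
      ∀ k a b : ℕ, 2 ^ k ≤ 8 * n → a * ε ≤ 40 * n → b * ε ≤ 40 * n →
        LeGridLine Y p u L ε (2 ^ k * S₀ / (4 * n)) (s'.realVar 6) a b := by
  refine EndsIn.setNat_seq ?_
  refine EndsIn.mono (EndsIn.loop (T := 11 + (10 + (2 +
      ((⌊40 * n / ε⌋₊ + 1 + 1) * (11 + (13 + (2 +
      ((⌊40 * n / ε⌋₊ + 1 + 1) * (11 + (gridLineProg.timeBound n + 4)) + 4)))) + 4)))) (fun m s' =>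
    HoldsSearch Y ε p u L S₀ s' ∧ s'.natVar 9 = 2 ^ m ∧
    ∀ k a b : ℕ, k < m → a * ε ≤ 40 * n → b * ε ≤ 40 * n →
        LeGridLine Y p u L ε (2 ^ k * S₀ / (4 * n)) (s'.realVar 6) a b)
    (Nat.log 2 (8 * n) + 1) ?_ ?_) ?_ ?_
  · exact ⟨hs.setNat (by norm_num) _, by simp, by simp⟩
  · rintro m s₁ ⟨h1, h2, h3⟩ htest
    simp [h2, h1.clients.hn] at htest
    have htest' : 2 ^ m ≤ 8 * n := by exact_mod_cast htest
    refine ⟨Nat.lt_succ_of_le (Nat.le_log_of_pow_le (by norm_num) htest'),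
      EndsIn.setReal_seq (EndsIn.setReal_seq (EndsIn.setNat_seq (EndsIn.seq (EndsIn.mono
      (gridProg_spec (g := 2 ^ m * S₀ / (4 * n)) hε (((h1.setReal (by norm_num) (by norm_num)
        _).setReal (by norm_num) (by norm_num) _).setNat
        (by norm_num) _) ?_ ?_ ?_).same le_rfl ?_))))⟩
    · simp [h2, h1.initial, h1.clients.hn]
    · simp [h2, h1.initial, h1.clients.hn, h1.eps]
    · simp
    rintro s₂ ⟨⟨g1, g2, g3⟩, g4⟩
    have g2 : s₂.realVar 6 ≤ s₁.realVar 6 := by simpa using g2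
    refine EndsIn.setNat ⟨g1.setNat (by norm_num) _, ?_, ?_⟩
    · have : s₂.natVar 9 = 2 ^ m := (g4.nat 9 rfl).trans (by simpa using h2)
      simp [this]
      ring
    · intro k a b hk ha hb
      rcases eq_or_lt_of_le (Nat.le_of_lt_succ hk) with rfl | hk
      · exact g3 a b ha hb
      · exact (h3 k a b hk ha hb).mono g2
  · exact le_rfl
  · rintro s' ⟨m, ⟨h1, h2, h3⟩, htest⟩
    simp [h2, h1.clients.hn] at htest
    refine ⟨h1, fun k a b hk ha hb => h3 k a b ?_ ha hb⟩
    have htest' : 8 * n < 2 ^ m := by exact_mod_cast htest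
    exact (Nat.pow_lt_pow_iff_right (by norm_num)).1 (hk.trans_lt htest')

/-- Doubling from `S / (4 n) ≤ V`, the first value that reaches `V` is at most `2 V`. Since `2 V ≤ 2
S`, its factor `2^k` is at most `8 n`. -/
theorem exists_scale {n : ℕ} (hn : 1 ≤ n) {S V : ℝ} (hS : 0 ≤ S) (hVS : V ≤ S)
    (hSV : S ≤ 4 * n * V) :
    ∃ k : ℕ, 2 ^ k ≤ 8 * n ∧ V ≤ 2 ^ k * S / (4 * n) ∧ 2 ^ k * S / (4 * n) ≤ 2 * V := by
  have hn' : (0 : ℝ) < 4 * n := by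
    have : (1 : ℝ) ≤ n := by exact_mod_cast hn
    linarith
  have hV : 0 ≤ V := by
    by_contra! h
    nlinarith
  have hex : ∃ k : ℕ, V ≤ 2 ^ k * S / (4 * n) := by
    obtain ⟨k, hk⟩ := pow_unbounded_of_one_lt (4 * n : ℝ) one_lt_two
    refine ⟨k, hVS.trans ?_⟩
    rw [le_div_iff₀ hn']
    nlinarith
  classical
  have hspec := Nat.find_spec hex
  rcases h : Nat.find hex with _ | k
  · rw [h] at hspec
    refine ⟨0, by omega, hspec, ?_⟩
    rw [div_le_iff₀ hn']
    nlinarith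
  · rw [h] at hspec
    have hlt : 2 ^ k * S / (4 * n) < V := not_le.1 (Nat.find_min hex (m := k) (by omega))
    have h2 : 2 ^ (k + 1) * S / (4 * n) ≤ 2 * V := by
      rw [pow_succ]
      linarith [show 2 ^ k * 2 * S / (4 * n) = 2 * (2 ^ k * S / (4 * n)) by ring]
    refine ⟨k + 1, ?_, hspec, h2⟩
    have hS0 : 0 < S := by
      rcases hS.eq_or_lt with h0 | h0
      · rw [← h0, mul_zero, zero_div] at hlt
        linarith
      · exact h0
    have h3 : (2 : ℝ) ^ (k + 1) ≤ 8 * n := by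
      rw [div_le_iff₀ hn'] at h2
      refine le_of_mul_le_mul_right ?_ hS0
      nlinarith
    exact_mod_cast h3

/-- The disk around the first client with a farthest client on its boundary is a cover. -/
theorem exists_cover_le {n k : ℕ} {Y : Fin n → Plane} {p u : ℂ} {L : ℝ} (h : IsFrame Y p u L)
    {D : Fin k → Disk} (hD : IsCollinearCover (Set.range Y) D) :
    ∃ (k' : ℕ) (D' : Fin k' → Disk), IsCollinearCover (Set.range Y) D' ∧ diskCost D' ≤ L ∧
      diskCost D' ≤ diskCost D := by
  by_cases hDL : diskCost D ≤ L
  · exact ⟨k, D, hD, hDL, le_rfl⟩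
  obtain ⟨i, hi⟩ := h.base
  refine ⟨1, fun _ => ⟨Y i, L⟩, ⟨fun _ => h.nonneg, ?_, ?_⟩, by simp [diskCost], ?_⟩
  · rw [Set.range_const]
    exact collinear_singleton _ _
  · rintro _ ⟨j, rfl⟩
    refine ⟨0, ?_⟩
    rw [dist_comm, Plane.dist_eq_norm, hi]
    exact h.le j
  · simpa [diskCost] using (not_le.1 hDL).le

/-- A value that is at most the initial one and the costs of all covers on grid lines is at most
`1 + ε` times the cost of any collinear cover. -/
theorem le_of_leGridLine {n k : ℕ} {Y : Fin n → Plane} {p u : ℂ} {L ε S v : ℝ}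
    (h : IsFrame Y p u L) (hε : 0 < ε) (hS : 0 ≤ S)
    (hSV : ∀ (k : ℕ) (D : Fin k → Disk), IsCollinearCover (Set.range Y) D →
      S ≤ 4 * n * diskCost D)
    (hvS : v ≤ S) (hv : ∀ k a b : ℕ, 2 ^ k ≤ 8 * n → a * ε ≤ 40 * n → b * ε ≤ 40 * n →
      LeGridLine Y p u L ε (2 ^ k * S / (4 * n)) v a b)
    {D : Fin k → Disk} (hD : IsCollinearCover (Set.range Y) D) : v ≤ (1 + ε) * diskCost D := by
  obtain ⟨k', D', hD', hL, hle⟩ := exists_cover_le h hD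
  have hV : 0 ≤ diskCost D' := Finset.sum_nonneg fun j _ => hD'.radius_nonneg j
  have hV' : (1 + ε) * diskCost D' ≤ (1 + ε) * diskCost D := by gcongr
  refine le_trans ?_ hV'
  -- If the given cover costs more than the projection, the bound `v ≤ S` already suffices.
  rcases le_or_gt (diskCost D') S with hVS | hVS
  · obtain ⟨i, -⟩ := h.base
    obtain ⟨m, hm, hg, hg'⟩ := exists_scale i.pos hS hVS (hSV k' D' hD')
    obtain ⟨a, b, ha, hb, T, hT, hcov, hsum⟩ := h.exists_grid_line hD' hL hε hg hg'
    exact (hv m a b hm ha hb T hT hcov).trans hsum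
  · nlinarith

/-- Compute a nearly optimal collinear disk cover. -/
def coverProg : Program :=
  frameProg ⨟ projectProg ⨟
  .cond (.realLe (.cast (.lit 4) * .cast (nv 0)) (rv 0)) .nop searchProg

/-- A bound for the running time of `searchProg`, given one for `gridLineProg`. -/
def searchBound (n N T : ℕ) : ℕ :=
  2 + (Nat.log 2 (8 * n) + 1 + 1) * (9 + (11 + (10 + (2 +
      ((N + 1 + 1) * (11 + (13 + (2 + ((N + 1 + 1) * (11 + (T + 4)) + 4)))) + 4)))))

theorem holdsClients_input {n : ℕ} (Y : Fin n → Plane) (ε : ℝ) : HoldsClients Y (input Y ε) where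
  hn := rfl
  fst := fun i => by simp [input]
  snd := fun i => by simp [input]

theorem coverProg_spec {n : ℕ} (hn : 1 ≤ n) (Y : Fin n → Plane) {ε : ℝ} (hε : 0 < ε) :
    EndsIn (frameProg.timeBound n + (projectProg.timeBound n +
        (8 + if 4 * n ≤ ε then 1 else searchBound n ⌊40 * n / ε⌋₊ (gridLineProg.timeBound n))))
      coverProg (input Y ε) fun s => HoldsCover Y s ∧
        ∀ (k : ℕ) (D : Fin k → Disk), IsCollinearCover (Set.range Y) D →
          s.realVar 6 ≤ (1 + ε) * diskCost D := by
  have hY := holdsClients_input Y ε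
  refine EndsIn.seq ((frameProg_spec hn hY).same.mono ?_)
  rintro s₁ ⟨hF, hs₁⟩
  have hY₁ : HoldsClients Y s₁ := by
    refine ⟨(hs₁.nat 0 rfl).trans hY.hn, ?_, ?_⟩
    · rw [hs₁.realArr 0 rfl]
      exact hY.fst
    · rw [hs₁.realArr 1 rfl]
      exact hY.snd
  refine EndsIn.seq ((projectProg_spec hY₁ hF).same.mono ?_)
  rintro s₂ ⟨⟨h1, h2, h3⟩, hs₂⟩
  have hY₂ : HoldsClients Y s₂ := by
    refine ⟨(hs₂.nat 0 rfl).trans hY₁.hn, ?_, ?_⟩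
    · rw [hs₂.realArr 0 rfl]
      exact hY₁.fst
    · rw [hs₂.realArr 1 rfl]
      exact hY₁.snd
  have heps : s₂.realVar 0 = ε := (hs₂.real 0 rfl).trans (hs₁.real 0 rfl)
  have hSV : ∀ (k : ℕ) (D : Fin k → Disk), IsCollinearCover (Set.range Y) D →
      s₂.realVar 6 ≤ 4 * n * diskCost D := fun k D hD => h3 _ (IsFrame.abs_im_le hF hD)
  have hS : 0 ≤ s₂.realVar 6 := by
    rw [← h1.cost]
    exact Finset.sum_nonneg fun j hj => h1.nonneg j (Finset.mem_range.1 hj)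
  split_ifs with hnε
  -- For `4 n ≤ ε` the projection costs at most `4 n V ≤ ε V` for every cover of cost `V`.
  · refine EndsIn.cond_true ?_ ⟨s₂, 1, .nop s₂, le_rfl, h1, fun k D hD => ?_⟩
    · simpa [heps, hY₂.hn] using hnε
    · have hV : 0 ≤ diskCost D := Finset.sum_nonneg fun j _ => hD.radius_nonneg j
      have := hSV k D hD
      nlinarith
  · refine EndsIn.cond_false ?_ (EndsIn.mono (searchProg_spec hε (S₀ := s₂.realVar 6)
      ⟨hY₂, h1, hF, heps, ?_, ?_, hs₂.real 5 rfl, h2, le_rfl⟩) le_rfl ?_)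
    · simpa [heps, hY₂.hn] using hnε
    · rw [hs₂.real 1 rfl, hs₂.real 2 rfl]
    · rw [hs₂.real 3 rfl, hs₂.real 4 rfl]
    · rintro s₃ ⟨g1, g2⟩
      exact ⟨g1.cover, fun k D hD => le_of_leGridLine hF hε hS hSV g1.le g2 hD⟩

/-! ### The running time -/

theorem searchBound_le {n N T A : ℕ} (hT : T ≤ A * (n + 1) ^ 2) :
    searchBound n N T ≤
      (2 + (36 + (30 + (15 + A)))) * ((Nat.log 2 (8 * n) + 2) * ((N + 2) ^ 2 * (n + 1) ^ 2)) := by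
  -- Additive overhead of each loop level is absorbed into the constant factor.
  have key : ∀ {c B P Q R : ℕ}, 0 < P → Q ≤ B * P → R = c + Q → R ≤ (c + B) * P := by
    intro c B P Q R hP hQ hR
    rw [hR, add_mul]
    exact add_le_add (Nat.le_mul_of_pos_right c hP) hQ
  have h1 : 11 + (T + 4) ≤ (15 + A) * (n + 1) ^ 2 := key (by positivity) hT (by ring)
  have h2 : (N + 1 + 1) * (11 + (T + 4)) ≤ (15 + A) * ((N + 2) * (n + 1) ^ 2) := by
    calc _ ≤ (N + 1 + 1) * ((15 + A) * (n + 1) ^ 2) := Nat.mul_le_mul le_rfl h1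
      _ = _ := by ring
  have h3 : 11 + (13 + (2 + ((N + 1 + 1) * (11 + (T + 4)) + 4))) ≤
      (30 + (15 + A)) * ((N + 2) * (n + 1) ^ 2) := key (by positivity) h2 (by ring)
  have h4 : (N + 1 + 1) * (11 + (13 + (2 + ((N + 1 + 1) * (11 + (T + 4)) + 4)))) ≤
      (30 + (15 + A)) * ((N + 2) ^ 2 * (n + 1) ^ 2) := by
    calc _ ≤ (N + 1 + 1) * ((30 + (15 + A)) * ((N + 2) * (n + 1) ^ 2)) := Nat.mul_le_mul le_rfl h3
      _ = _ := by ring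
  have h5 := key (c := 36) (by positivity) h4 rfl
  have h6 := Nat.mul_le_mul (le_refl (Nat.log 2 (8 * n) + 2)) h5
  refine key (by positivity) (h6.trans (le_of_eq ?_)) ?_
  · ring
  · unfold searchBound
    ring

/-- The left side is at most `5 + log n / log 2`, hence at most `6 log (n + 1) / log 2`, and `log 2
> 1 / 2`. -/
theorem log_two_mul_le {n : ℕ} (hn : 1 ≤ n) :
    ((Nat.log 2 (8 * n) + 2 : ℕ) : ℝ) ≤ 12 * Real.log (n + 1) := by
  have hn' : (1 : ℝ) ≤ n := by exact_mod_cast hn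
  have h2 := Real.log_two_gt_d9
  have hlog : Real.log 2 ≤ Real.log (n + 1) := Real.log_le_log (by norm_num) (by linarith)
  have h1 : ((2 : ℝ) ^ Nat.log 2 (8 * n)) ≤ 8 * n := by
    exact_mod_cast Nat.pow_log_le_self 2 (by omega)
  have h3 := Real.log_le_log (by positivity) h1
  rw [Real.log_pow, Real.log_mul (by norm_num) (by positivity),
    show (8 : ℝ) = 2 ^ 3 by norm_num, Real.log_pow] at h3
  have h4 : Real.log n ≤ Real.log (n + 1) := Real.log_le_log (by linarith) (by linarith)
  push_cast at h3 ⊢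
  nlinarith [Nat.cast_nonneg (α := ℝ) (Nat.log 2 (8 * n))]

/-- The search is only run for `ε < 4 n`; then `1 ≤ 4 n / ε`, and the summand `2` costs at most `8 n
/ ε`. -/
theorem floor_add_two_le {n : ℕ} {ε : ℝ} (hε : 0 < ε) (h : ε < 4 * n) :
    ((⌊40 * n / ε⌋₊ + 2 : ℕ) : ℝ) ≤ 48 * (n / ε) := by
  have h1 := Nat.floor_le (a := 40 * n / ε) (by positivity)
  have h2 : 1 ≤ 4 * (n / ε) := by
    rw [← mul_div_assoc, le_div_iff₀ hε]
    linarith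
  push_cast
  rw [mul_div_assoc] at h1 ⊢
  linarith

theorem exists_time_bound : ∃ C : ℝ, ∀ n : ℕ, 1 ≤ n → ∀ ε : ℝ, 0 < ε →
    ((frameProg.timeBound n + (projectProg.timeBound n + (8 + if 4 * n ≤ ε then 1 else
      searchBound n ⌊40 * n / ε⌋₊ (gridLineProg.timeBound n))) : ℕ) : ℝ) ≤
      C * (((n : ℝ) ^ 4 / ε ^ 2 + n) * Real.log (n + 1)) := by
  obtain ⟨A, hA⟩ : ∃ A : ℕ, ∀ n, gridLineProg.timeBound n ≤ A * (n + 1) ^ 2 :=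
    ⟨_, fun n => gridLineProg.timeBound_le n⟩
  obtain ⟨A₁, hA₁⟩ : ∃ A : ℕ, ∀ n, frameProg.timeBound n ≤ A * (n + 1) ^ 1 :=
    ⟨_, fun n => frameProg.timeBound_le n⟩
  obtain ⟨A₂, hA₂⟩ : ∃ A : ℕ, ∀ n, projectProg.timeBound n ≤ A * (n + 1) ^ 1 :=
    ⟨_, fun n => projectProg.timeBound_le n⟩
  obtain ⟨K, hK⟩ : ∃ K : ℕ, K = 2 + (36 + (30 + (15 + A))) := ⟨_, rfl⟩
  refine ⟨4 * (A₁ + A₂ + 9) + K * (12 * 48 ^ 2 * 4), fun n hn ε hε => ?_⟩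
  have hn' : (1 : ℝ) ≤ n := by exact_mod_cast hn
  have hlog2 : 1 ≤ 2 * Real.log (n + 1) := by
    have h2 := Real.log_two_gt_d9
    have : Real.log 2 ≤ Real.log (n + 1) := Real.log_le_log (by norm_num) (by linarith)
    linarith
  have hl0 : 0 ≤ Real.log (n + 1) := by linarith
  have h1 : (frameProg.timeBound n : ℝ) ≤ A₁ * (n + 1) := by exact_mod_cast (pow_one (n + 1)) ▸ hA₁ n
  have h2 : (projectProg.timeBound n : ℝ) ≤ A₂ * (n + 1) := by
    exact_mod_cast (pow_one (n + 1)) ▸ hA₂ n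
  have h3 : ((if 4 * n ≤ ε then 1 else
      searchBound n ⌊40 * n / ε⌋₊ (gridLineProg.timeBound n) : ℕ) : ℝ) ≤
      1 + K * (12 * 48 ^ 2 * 4) * ((n : ℝ) ^ 4 / ε ^ 2 * Real.log (n + 1)) := by
    split_ifs with h
    · push_cast
      have : 0 ≤ K * (12 * 48 ^ 2 * 4) * ((n : ℝ) ^ 4 / ε ^ 2 * Real.log (n + 1)) := by positivity
      linarith
    · have h4 : (searchBound n ⌊40 * n / ε⌋₊ (gridLineProg.timeBound n) : ℝ) ≤
          K * (((Nat.log 2 (8 * n) + 2 : ℕ) : ℝ) * (((⌊40 * n / ε⌋₊ + 2 : ℕ) : ℝ) ^ 2 *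
            ((n : ℝ) + 1) ^ 2)) := by
        rw [hK]
        exact_mod_cast searchBound_le (hA n)
      have h5 := floor_add_two_le hε (not_le.1 h)
      have h6 := log_two_mul_le hn
      calc _ ≤ _ := h4
        _ ≤ K * (12 * Real.log (n + 1) * ((48 * (n / ε)) ^ 2 * (2 * n) ^ 2)) := by
          gcongr
          linarith
        _ = K * (12 * 48 ^ 2 * 4) * ((n : ℝ) ^ 4 / ε ^ 2 * Real.log (n + 1)) := by
          field_simp
          ring
        _ ≤ _ := by linarith
  -- The linear part, for the frame, the projection and the final test, goes into the summand `n log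
  -- (n + 1)`.
  have h7 : (A₁ + A₂ + 9) * (n + 1) ≤ 4 * (A₁ + A₂ + 9) * (n * Real.log (n + 1)) := by
    have : (n : ℝ) + 1 ≤ 4 * (n * Real.log (n + 1)) := by nlinarith
    have h8 : (0 : ℝ) ≤ A₁ + A₂ + 9 := by positivity
    nlinarith
  have h9 : 0 ≤ 4 * (A₁ + A₂ + 9) * ((n : ℝ) ^ 4 / ε ^ 2 * Real.log (n + 1)) := by positivity
  have h10 : 0 ≤ K * (12 * 48 ^ 2 * 4) * (n * Real.log (n + 1)) := by positivity
  push_cast at h3 ⊢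
  nlinarith

end RealRAM

/-- There is one real RAM program that, for all `n ≥ 1` distinct clients `Y` in the plane and all
`ε > 0`, halts within `O((n ^ 4 / ε ^ 2 + n) log (n + 1))` steps with a collinear disk cover of `Y`
of cost at most `(1 + ε) OPT`. -/
theorem mainTheorem7 :
    ∃ (P : RealRAM.Program) (C : ℝ),
      ∀ (n : ℕ), 1 ≤ n → ∀ (Y : Fin n → Plane), Function.Injective Y → ∀ (ε : ℝ), 0 < ε →
        ∃ (s : RealRAM.Store) (t : ℕ),
          RealRAM.Run P (RealRAM.input Y ε) s t ∧
          IsCollinearCover (Set.range Y) (RealRAM.output s) ∧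
          diskCost (RealRAM.output s) ≤ (1 + ε) * collinearOpt (Set.range Y) ∧
          (t : ℝ) ≤ C * (((n : ℝ) ^ 4 / ε ^ 2 + n) * Real.log (n + 1)) := by
  obtain ⟨C, hC⟩ := RealRAM.exists_time_bound
  refine ⟨RealRAM.coverProg, C, fun n hn Y _ ε hε => ?_⟩
  obtain ⟨s, t, hrun, ht, hcov, hopt⟩ := RealRAM.coverProg_spec hn Y hε
  refine ⟨s, t, hrun, hcov.isCollinearCover, ?_, le_trans (by exact_mod_cast ht) (hC n hn ε hε)⟩
  rw [hcov.diskCost, ← div_le_iff₀' (by linarith)]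
  -- The computed cover itself shows that the infimum is over a nonempty set.
  refine le_csInf ⟨_, _, _, hcov.isCollinearCover, rfl⟩ ?_
  rintro _ ⟨k, D, hD, rfl⟩
  rw [div_le_iff₀' (by linarith)]
  exact hopt k D hD
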